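/- Let $K$ be a field and let $A,B\subset K$ be finite sets with $|A|=m$, $|B|=n$, $1\le m\le n$ (for instance, $A$ and $B$ may consist of distinct indeterminates, with $K$ a field of rational functions in them). Let $$f=\prod_{\alpha\in A}(x-\alpha)=\sum_{i=0}^m a_ix^i,\qquad g=\prod_{\beta\in B}(x-\beta)=\sum_{i=0}^n b_ix^i ,$$ and put $a_\ell=0$ for $\ell<0$ or $\ell>m$, and $b_\ell=0$ for $\ell<0$ or $\ell>n$. For finite sets $Y,Z\subset K$ write $R(Y,Z)=\prod_{y\in Y,\,z\in Z}(y-z)$ and $R(x,Z)=\prod_{z\in Z}(x-z)$, empty products being $1$. For $0\le p\le m$ and $0\le q\le n$ the Sylvester double sum is $$\operatorname{Sylv}^{p,q}(A,B)=\sum_{\substack{A'\subset A,\ B'\subset B\\ |A'|=p,\ |B'|=q}}R(x,A')\,R(x,B')\,\frac{R(A',B')\,R(A\setminus A',B\setminus B')}{R(A',A\setminus A')\,R(B',B\setminus B')}\in K[x].$$ For $0\le k\le m$ if $m<n$, and $0\le k\le m-1$ if $m=n$, and for $u,v\in K[x]$, let $M_k(u,v)$ be the square matrix of size $m+n-2k$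 whose first $m+n-2k-1$ columns, $j=0,1,\dots,m+n-2k-2$, have the entries $a_{m+i-j}$ in the upper rows $i=0,\dots,n-k-1$ and the entries $b_{n+i-j}$ in the lower rows $i=0,\dots,m-k-1$, and whose last column has the entries $x^{n-k-1-i}u$ in the upper rows and $x^{m-k-1-i}v$ in the lower rows. Define $$\operatorname{Sres}_k(f,g)=\det M_k(f,g),\qquad F_k(f,g)=\det M_k(1,0),\qquad G_k(f,g)=\det M_k(0,1),$$ so that $\operatorname{Sres}_k(f,g)=F_k(f,g)f+G_k(f,g)g$. Let $\operatorname{Res}(f,g)=\prod_{\alpha\in A}g(\alpha)$ be the resultant. Let $0\le p\le m$, $0\le q\le n$, $k=p+q$, and put $\bar p=m-p$, $\bar q=n-q$, $\bar k=m+n-k-1$ and $c=\bar p\,\bar q+n-p-1+nq$. Then, for $(p,q)\neq(m,n)$: - if $m<n$, $$\operatorname{Sylv}^{p,q}(A,B)=\begin{cases}(-1)^{p(m-k)}\binom kp\operatorname{Sres}_k(f,g)&\text{for }0\le k\le m,\\ 0&\text{for }m+1\le k\le n-2,\\ (-1)^c\Big(\binom{\bar k}{\bar p}F_{\bar k}(f,g)\,f-\binom{\bar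 k}{\bar q}G_{\bar k}(f,g)\,g\Big)&\text{for }n-1\le k\le m+n-1;\end{cases}$$ - if $m=n$, $$\operatorname{Sylv}^{p,q}(A,B)=\begin{cases}(-1)^{p(m-k)}\binom kp\operatorname{Sres}_k(f,g)&\text{for }0\le k\le m-1,\\ (-1)^c\Big(\binom{\bar k}{\bar p}F_{\bar k}(f,g)\,f-\binom{\bar k}{\bar q}G_{\bar k}(f,g)\,g\Big)&\text{for }m\le k\le 2m-1.\end{cases}$$ (For $m<n$ and $k=m=n-1$ both the first and the last formula hold.) Finally, $\operatorname{Sylv}^{m,n}(A,B)=\operatorname{Res}(f,g)\,f\,g$. -/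

import Mathlib

open Polynomial

noncomputable section

namespace SylvesterSums

/-- `R(Y, Z) = ∏_{y ∈ Y, z ∈ Z} (y - z)`, with empty products equal to `1`. -/
def diffProd {K : Type*} [Field K] (Y Z : Finset K) : K :=
  ∏ y ∈ Y, ∏ z ∈ Z, (y - z)

/-- `R(x, Z) = ∏_{z ∈ Z} (x - z)`, the monic polynomial with simple roots `Z`. -/
def rootPoly {K : Type*} [Field K] (Z : Finset K) : K[X] :=
  ∏ z ∈ Z, (X - C z)

/-- Sylvester's double sum `Sylv^{p,q}(A, B)`. The denominators are nonzero since each of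
`A` and `B` consists of distinct elements. -/
def doubleSum {K : Type*} [Field K] [DecidableEq K] (p q : ℕ) (A B : Finset K) : K[X] :=
  ∑ A' ∈ A.powersetCard p, ∑ B' ∈ B.powersetCard q,
    rootPoly A' * rootPoly B' *
      C ((diffProd A' B' * diffProd (A \ A') (B \ B')) /
        (diffProd A' (A \ A') * diffProd B' (B \ B')))

/-- The coefficient of `h` of index `s - j`, which is `0` if the index is negative. -/
def coeffSub {R : Type*} [CommRing R] (h : R[X]) (s j : ℕ) : R :=
  if j ≤ s then h.coeff (s - j) else 0

/-- The square matrix of size `(n - k) + (m - k)` attached to `f` of degree `m` and `g` of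
degree `n`. Apart from the last column, row `i` of the upper block of `n - k` rows has
entries `a_{m+i-j}` and row `i` of the lower block of `m - k` rows has entries `b_{n+i-j}`
(rows and columns counted from `0`), where the `a`'s and `b`'s are the coefficients of `f`
and `g`. The last column is
`x^{n-k-1} u, …, x^0 u` in the upper block and `x^{m-k-1} v, …, x^0 v` in the lower one. -/
def subresMatrix {R : Type*} [CommRing R] (f g : R[X]) (m n k : ℕ) (u v : R[X]) :
    Matrix (Fin ((n - k) + (m - k))) (Fin ((n - k) + (m - k))) R[X] :=
  Matrix.of fun i j =>
    Fin.addCases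
      (fun i : Fin (n - k) =>
        if (j : ℕ) + 1 = (n - k) + (m - k) then X ^ (n - k - 1 - (i : ℕ)) * u
        else C (coeffSub f (m + i) j))
      (fun i : Fin (m - k) =>
        if (j : ℕ) + 1 = (n - k) + (m - k) then X ^ (m - k - 1 - (i : ℕ)) * v
        else C (coeffSub g (n + i) j))
      i

/-- The `k`-th subresultant `Sres_k(f, g)` of `f` of degree `m` and `g` of degree `n`. -/
def Sres {R : Type*} [CommRing R] (f g : R[X]) (m n k : ℕ) : R[X] :=
  (subresMatrix f g m n k f g).det

/-- The cofactor `F_k(f, g)` of `f` in `Sres_k(f, g)`. -/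
def cofF {R : Type*} [CommRing R] (f g : R[X]) (m n k : ℕ) : R[X] :=
  (subresMatrix f g m n k 1 0).det

/-- The cofactor `G_k(f, g)` of `g` in `Sres_k(f, g)`. -/
def cofG {R : Type*} [CommRing R] (f g : R[X]) (m n k : ℕ) : R[X] :=
  (subresMatrix f g m n k 0 1).det

/-- `(-1)^c (binom(k̄, p̄) F_k̄(f, g) f - binom(k̄, q̄) G_k̄(f, g) g)`, where `p̄ = m - p`,
`q̄ = n - q`, `k̄ = m + n - (p + q) - 1` and `c = p̄ q̄ + n - p - 1 + n q`. The integer `c` can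
be negative, whence an integer power of `-1`. -/
def largeValue {K : Type*} [Field K] (f g : K[X]) (m n p q : ℕ) : K[X] :=
  C ((-1 : K) ^ (((m : ℤ) - p) * ((n : ℤ) - q) + (n : ℤ) - p - 1 + (n : ℤ) * q)) *
    (((m + n - (p + q) - 1).choose (m - p) : K[X]) * cofF f g m n (m + n - (p + q) - 1) * f
      - ((m + n - (p + q) - 1).choose (n - q) : K[X]) * cofG f g m n (m + n - (p + q) - 1) * g)

end SylvesterSums

end

/-! Take the points `b_1, …, b_n, x, a_1, …, a_m` and a square matrix whose rows are powers of these
points in two blocks of `L = n + m - κ` and `κ + 1` columns, the row of a point being scaled by a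
weight `β` in the first block and by `σ` in the second. In the Laplace expansion along the blocks
(`det_twoBlock_eq_sum`) each term belongs to a set `s` of `κ + 1` rows and is, up to sign, a product
of two Vandermonde determinants, that is, the full Vandermonde determinant divided by the
differences between `s` and its complement (`blockDet_mul_prod`). If `A'` and `B'` collect the
points on the same side as `x`, this term is, up to sign and the factor `V(a) V(b)`, the summand of
the double sum at `(A', B')`. Placing `x` in the second block gives the double sums with `p + q =
κ`, placing it in the first those with `p + q = m + n - κ - 1`.

Let the weights `(β, σ)` be `(1, 1)` on `b`, `(1, t)` on `a` and `(d, c)` at `x`. The coefficients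
in `t` of the determinant then separate the sizes of the sets. If `2κ + 1 ≤ m + n`, subtracting the
first columns from the second block changes the weights to `(1, 0)`, `(1, t - 1)` and `(d, c - d)`.
By homogeneity the determinant is a combination of `(t - 1)^κ` and `(t - 1)^(κ+1)` with coefficients
free of `t` (`det_twoBlock_generating`); the binomial coefficients of the theorem come from these
powers.

It remains to compute `reducedDet`. If `κ > m`, its second block has more columns than nonzero rows,
so it vanishes. If `κ ≤ m` and `κ < n`, dividing by `g` removes the rows `b`, and a factorization
through coefficient vectors removes the rows `a`; up to sign and `V(a) V(b)` this leaves `-μ F_κ f +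
(ν - μ) G_κ g`. For `(ν, μ) = (0, 1)` this is `-Sres_κ`, for `(1, 0)` it is `G_κ g`, and Pascal's
rule combines the two into the formula for large `p + q`. -/

noncomputable section

namespace SylvesterSums

/-! ### Determinants indexed by `ℕ`: block triangular form, rotations and reversal. -/

section NatDet

variable {R : Type*} [CommRing R]

/-- The determinant of the leading `N × N` block of an infinite matrix indexed by `ℕ`. -/
def natDet (N : ℕ) (M : ℕ → ℕ → R) : R :=
  (Matrix.of fun i j : Fin N => M i j).det

theorem natDet_congr {N : ℕ} {M M' : ℕ → ℕ → R}
    (h : ∀ i < N, ∀ j < N, M i j = M' i j) : natDet N M = natDet N M' := by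
  unfold natDet
  congr 1
  ext i j
  exact h i i.2 j j.2

theorem natDet_mul (N : ℕ) (M P : ℕ → ℕ → R) :
    natDet N (fun i j => ∑ l ∈ Finset.range N, M i l * P l j) = natDet N M * natDet N P := by
  unfold natDet
  rw [← Matrix.det_mul]
  congr 1
  ext i j
  simp [Matrix.mul_apply, Finset.sum_range]

theorem natDet_transpose (N : ℕ) (M : ℕ → ℕ → R) :
    natDet N (fun i j => M j i) = natDet N M := by
  unfold natDet
  rw [← Matrix.det_transpose]
  rfl

theorem natDet_add_of_lower_zero (a b : ℕ) (M : ℕ → ℕ → R)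
    (h : ∀ i < b, ∀ j < a, M (a + i) j = 0) :
    natDet (a + b) M = natDet a M * natDet b (fun i j => M (a + i) (a + j)) := by
  unfold natDet
  rw [← Matrix.det_fromBlocks_zero₂₁ _ (Matrix.of fun (i : Fin a) (j : Fin b) => M i (a + j)),
    ← Matrix.det_submatrix_equiv_self (finSumFinEquiv (m := a) (n := b))]
  congr 1
  ext i j
  rcases i with i | i <;> rcases j with j | j <;> simp
  exact h i i.2 j j.2

theorem natDet_add_of_upper_zero (a b : ℕ) (M : ℕ → ℕ → R)
    (h : ∀ i < a, ∀ j < b, M i (a + j) = 0) :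
    natDet (a + b) M = natDet a M * natDet b (fun i j => M (a + i) (a + j)) := by
  rw [← natDet_transpose, natDet_add_of_lower_zero a b _ fun i hi j hj => h j hj i hi,
    natDet_transpose a M, natDet_transpose b fun i j => M (a + i) (a + j)]

theorem natDet_eq_one_of_upperTriangular (N : ℕ) (M : ℕ → ℕ → R)
    (h : ∀ i < N, ∀ j < i, M i j = 0) (h1 : ∀ i < N, M i i = 1) : natDet N M = 1 := by
  unfold natDet
  rw [Matrix.det_of_isUpperTriangular]
  · simp only [Matrix.of_apply]
    exact Finset.prod_eq_one fun i _ => h1 i i.2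
  · intro i j hij
    exact h i i.2 j hij

theorem natDet_rotate_one (N : ℕ) (M : ℕ → ℕ → R) :
    natDet (N + 1) (fun i j => M i (if j = 0 then N else j - 1)) =
      (-1) ^ N * natDet (N + 1) M := by
  unfold natDet
  have := Matrix.det_permute' (finRotate (N + 1))⁻¹ (Matrix.of fun i j : Fin (N + 1) => M i j)
  rw [Equiv.Perm.sign_inv, sign_finRotate] at this
  simp only [add_tsub_cancel_right, Units.val_pow_eq_pow_val, Units.val_neg, Units.val_one,
    Int.cast_pow, Int.cast_neg, Int.cast_one] at this
  rw [← this]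
  congr 1
  ext i j
  simp only [Matrix.of_apply, Matrix.submatrix_apply, id]
  congr 1
  have h : ∀ c : Fin (N + 1), ((if ((finRotate (N + 1) c : Fin (N + 1)) : ℕ) = 0 then N
      else ((finRotate (N + 1) c : Fin (N + 1)) : ℕ) - 1) : ℕ) = c := by
    intro c
    rw [coe_finRotate]
    split_ifs with h1 h2 h2
    · rw [h1]; rfl
    · simp at h2
    · simp at h2
    · simp
  simpa using h ((finRotate (N + 1))⁻¹ j)

theorem natDet_rotate_pow (N a : ℕ) (ha : a ≤ N + 1) (M : ℕ → ℕ → R) :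
    natDet (N + 1) (fun i j => M i (if j < a then N + 1 - a + j else j - a)) =
      ((-1) ^ N) ^ a * natDet (N + 1) M := by
  induction a generalizing M with
  | zero => simp
  | succ a ih =>
    rw [pow_succ, mul_assoc, ← natDet_rotate_one, ← ih (by omega)]
    refine natDet_congr fun i hi j hj => ?_
    congr 1
    split_ifs <;> omega

theorem natDet_rotate (a b : ℕ) (M : ℕ → ℕ → R) :
    natDet (a + b) (fun i j => M i (if j < a then b + j else j - a)) =
      (-1) ^ (a * b) * natDet (a + b) M := by
  obtain h | ⟨N, h⟩ : a + b = 0 ∨ ∃ N, a + b = N + 1 := by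
    rcases h : a + b with _ | N
    · exact Or.inl rfl
    · exact Or.inr ⟨N, rfl⟩
  · obtain ⟨rfl, rfl⟩ : a = 0 ∧ b = 0 := by omega
    simp
  · have hb : b = N + 1 - a := by omega
    have := natDet_rotate_pow N a (by omega) M
    rw [← hb] at this
    rw [h, this, ← pow_mul]
    congr 1
    -- `N * a` and `a * b` have the same parity, since they differ by `a * (a - 1)`.
    refine neg_one_pow_congr ?_
    have h' : N + 1 = a + b := h.symm
    have h'' := congrArg (fun t => Even (t * a)) h'
    simp only [eq_iff_iff] at h''
    simp only [add_mul, one_mul, Nat.even_add, Nat.even_mul] at *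
    tauto

theorem natDet_move_row {c N : ℕ} (hc : c < N) (M : ℕ → ℕ → R) :
    natDet N (fun i j => M (if i = 0 then c else if i ≤ c then i - 1 else i) j) =
      (-1) ^ c * natDet N M := by
  unfold natDet
  have := Matrix.det_permute (Fin.cycleRange (⟨c, hc⟩ : Fin N))⁻¹
    (Matrix.of fun i j : Fin N => M i j)
  rw [Equiv.Perm.sign_inv, Fin.sign_cycleRange] at this
  simp only [Units.val_pow_eq_pow_val, Units.val_neg, Units.val_one,
    Int.cast_pow, Int.cast_neg, Int.cast_one] at this
  rw [← this]
  congr 1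
  ext i j
  simp only [Matrix.of_apply, Matrix.submatrix_apply, id]
  congr 1
  have h : ∀ d : Fin N, ((if ((Fin.cycleRange (⟨c, hc⟩ : Fin N) d : Fin N) : ℕ) = 0 then c
      else if ((Fin.cycleRange (⟨c, hc⟩ : Fin N) d : Fin N) : ℕ) ≤ c then
        ((Fin.cycleRange (⟨c, hc⟩ : Fin N) d : Fin N) : ℕ) - 1
      else ((Fin.cycleRange (⟨c, hc⟩ : Fin N) d : Fin N) : ℕ)) : ℕ) = d := by
    intro d
    rcases le_or_gt d ⟨c, hc⟩ with h | h
    · rw [Fin.coe_cycleRange_of_le h]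
      simp only [Fin.ext_iff, Fin.le_def] at *
      split_ifs <;> simp_all; omega
    · rw [Fin.cycleRange_of_gt h]
      simp only [Fin.lt_def] at *
      split_ifs <;> omega
  simpa using h ((Fin.cycleRange (⟨c, hc⟩ : Fin N))⁻¹ i)

theorem natDet_rev (N : ℕ) (M : ℕ → ℕ → R) :
    natDet N (fun i j => M (N - 1 - i) (N - 1 - j)) = natDet N M := by
  unfold natDet
  rw [← Matrix.det_submatrix_equiv_self Fin.revPerm (Matrix.of fun i j : Fin N => M i j)]
  congr 1
  ext i j
  simp only [Matrix.of_apply, Matrix.submatrix_apply, Fin.revPerm_apply, Fin.val_rev]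
  congr 1 <;> omega

end NatDet

/-! ### Reduction of the two-block determinant to a Sylvester-type determinant. -/

section Reduction

variable {R : Type*} [CommRing R]

/-- The matrix whose `i`-th row consists of the first `L` powers of `z i`, scaled by `β i`,
followed by the powers of `z i`, scaled by `σ i`. -/
def twoBlock {ι : Type*} (L : ℕ) (z β σ : ι → R) (i : ι) (j : ℕ) : R :=
  if j < L then β i * z i ^ j else σ i * z i ^ (j - L)

/-- The Sylvester-type matrix whose columns are given by the polynomials `x ^ j * g`
(for `j < m - k`) and `x ^ j * f`. The first row holds values at `x`, weighted by `v` and `u`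
respectively, the other rows the coefficients of index above `k`. -/
def subresCore (f g : R[X]) (m k : ℕ) (x u v : R) (i j : ℕ) : R :=
  if i = 0 then
    if j < m - k then v * (x ^ j * g.eval x) else u * (x ^ (j - (m - k)) * f.eval x)
  else if j < m - k then (X ^ j * g).coeff (k + i) else (X ^ (j - (m - k)) * f).coeff (k + i)

theorem sum_pow_mul_coeff (p : R[X]) (z : R) {L : ℕ} (h : p.natDegree < L) :
    ∑ l ∈ Finset.range L, z ^ l * p.coeff l = p.eval z := by
  rw [eval_eq_sum_range' h]
  exact Finset.sum_congr rfl fun _ _ => mul_comm _ _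

theorem natDegree_X_pow_mul_lt {p : R[X]} {d e L : ℕ} (hp : p.natDegree = d) (h : e + d < L) :
    (X ^ e * p).natDegree < L :=
  natDegree_mul_le.trans_lt (by have := natDegree_X_pow_le (R := R) e; omega)

theorem Monic.coeff_X_pow_mul_self {p : R[X]} (hp : p.Monic) {d e j : ℕ}
    (hd : p.natDegree = d) (hj : j = e + d) : (X ^ e * p).coeff j = 1 := by
  rw [hj, add_comm, coeff_X_pow_mul, ← hd]
  exact hp

/-- Divisibility by `g` allows one to split off the rows of roots of `g`. -/
theorem natDet_twoBlock_split (g : R[X]) {m n k : ℕ} (hg : g.Monic) (hgn : g.natDegree = n)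
    (hkm : k ≤ m) (z β σ : ℕ → R) (hz : ∀ i < n, g.eval (z i) = 0)
    (hβ : ∀ i < n, β i = 1) (hσ : ∀ i < n, σ i = 0) :
    natDet (n + (m + 1)) (twoBlock (n + m - k) z β σ) =
      natDet n (fun i j => z i ^ j) *
      natDet (m + 1) (fun i j => if j < m - k then β (n + i) * (z (n + i) ^ j * g.eval (z (n + i)))
        else σ (n + i) * z (n + i) ^ (j - (m - k))) := by
  -- Multiplying by the unitriangular coefficient matrix of these monic polynomials turns the
  -- columns `n ≤ j < n + m - k` into multiples of `g`, which vanish in the first `n` rows. The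
  -- degrees stay below `n + m - k`, so the second block does not interfere.
  set p : ℕ → R[X] := fun j => if n ≤ j ∧ j < n + m - k then X ^ (j - n) * g else X ^ j with hp
  have hC : natDet (n + (m + 1)) (fun l j => (p j).coeff l) = 1 := by
    refine natDet_eq_one_of_upperTriangular _ _ (fun i _ j hj => ?_) (fun i _ => ?_)
    · simp only [hp]
      split_ifs with h
      · exact coeff_eq_zero_of_natDegree_lt (natDegree_X_pow_mul_lt hgn (by omega))
      · rw [coeff_X_pow, if_neg (by omega)]
    · simp only [hp]
      split_ifs with h
      · exact Monic.coeff_X_pow_mul_self hg hgn (by omega)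
      · rw [coeff_X_pow, if_pos rfl]
  rw [← mul_one (natDet _ (twoBlock _ _ _ _)), ← hC, ← natDet_mul]
  have key : ∀ i < n + (m + 1), ∀ j < n + (m + 1),
      ∑ l ∈ Finset.range (n + (m + 1)), twoBlock (n + m - k) z β σ i l * (p j).coeff l =
        if n ≤ j ∧ j < n + m - k then β i * (z i ^ (j - n) * g.eval (z i))
        else twoBlock (n + m - k) z β σ i j := by
    intro i _ j hj
    simp only [hp]
    split_ifs with h
    · have hdeg : (X ^ (j - n) * g).natDegree < n + m - k :=
        natDegree_X_pow_mul_lt hgn (by omega)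
      rw [show n + (m + 1) = (n + m - k) + (k + 1) by omega, Finset.sum_range_add,
        Finset.sum_eq_zero (s := Finset.range (k + 1)), add_zero]
      · rw [show z i ^ (j - n) * g.eval (z i) = (X ^ (j - n) * g).eval (z i) by simp,
          ← sum_pow_mul_coeff _ _ hdeg, Finset.mul_sum]
        refine Finset.sum_congr rfl fun l hl => ?_
        rw [twoBlock, if_pos (Finset.mem_range.1 hl), mul_assoc]
      · intro l _
        rw [coeff_eq_zero_of_natDegree_lt (by omega), mul_zero]
    · rw [Finset.sum_eq_single j]
      · simp
      · intro l _ hl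
        rw [coeff_X_pow, if_neg hl, mul_zero]
      · intro h'
        simp at h'
        omega
  rw [natDet_congr key, natDet_add_of_upper_zero]
  · congr 1
    · refine natDet_congr fun i hi j hj => ?_
      rw [if_neg (by omega), twoBlock, if_pos (by omega), hβ i hi, one_mul]
    · refine natDet_congr fun i hi j hj => ?_
      by_cases h : j < m - k
      · rw [if_pos (by omega), if_pos h, Nat.add_sub_cancel_left]
      · rw [if_neg (by omega), if_neg h, twoBlock, if_neg (by omega)]
        congr 2
        omega
  · intro i hi j hj
    split_ifs with h
    · rw [hz i hi, mul_zero, mul_zero]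
    · rw [twoBlock, if_neg (by omega), hσ i hi, zero_mul]

/-- The determinant with rows indexed by `x` and the roots of `f`, and columns
`1, …, x ^ k, g, …, x ^ (m - k - 1) * g`. -/
theorem natDet_roots_eq_subresCore (f g : R[X]) {m n k : ℕ} (hf : f.Monic)
    (hfm : f.natDegree = m) (hgn : g.natDegree = n) (hkm : k ≤ m) (hkn : k < n)
    (a : ℕ → R) (ha : ∀ i < m, f.eval (a i) = 0) (x μ ν : R) :
    natDet (m + 1) (fun i j => if i = 0 then
        (if j < k + 1 then μ * x ^ j else ν * (x ^ (j - (k + 1)) * g.eval x))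
        else (if j < k + 1 then a (i - 1) ^ j
          else a (i - 1) ^ (j - (k + 1)) * g.eval (a (i - 1)))) =
      (-1) ^ (k + 1) * natDet m (fun i j => a i ^ j) *
        natDet ((n - k) + (m - k)) (subresCore f g m k x (-μ) (ν - μ)) := by
  -- The matrix is enlarged by the columns `x ^ e * f`, which vanish at the roots of `f`, and by
  -- rows of coefficients of index at least `m`, which are unitriangular on these columns. The
  -- enlarged matrix `F` factors as evaluation `Q` times coefficients `P`.
  set q : ℕ → R[X] := fun j => if j < k + 1 then X ^ j else if j < m + 1 then X ^ (j - (k + 1)) * g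
    else X ^ (j - (m + 1)) * f with hq
  have hqdeg : ∀ j < n + m - k + 1, (q j).natDegree < n + m - k := by
    intro j hj
    simp only [hq]
    split_ifs with h h'
    · exact (natDegree_X_pow_le j).trans_lt (by omega)
    · exact natDegree_X_pow_mul_lt hgn (by omega)
    · exact natDegree_X_pow_mul_lt hfm (by omega)
  -- `w` corrects `μ * q_j(x)` to the prescribed row at `x`, with zeros in the columns `x ^ e * f`;
  -- this is the source of the weights `ν - μ` and `-μ`.
  set w : ℕ → R := fun j => if j < k + 1 then 0 else if j < m + 1 then
    (ν - μ) * (x ^ (j - (k + 1)) * g.eval x) else -μ * (x ^ (j - (m + 1)) * f.eval x) with hw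
  set P : ℕ → ℕ → R := fun l j => if l = 0 then w j else (q j).coeff (l - 1) with hP
  set Q : ℕ → ℕ → R := fun i l => if i = 0 then (if l = 0 then 1 else μ * x ^ (l - 1))
    else if l = 0 then 0 else if i < m + 1 then a (i - 1) ^ (l - 1)
      else if i = l then 1 else 0 with hQ
  set F : ℕ → ℕ → R := fun i j => if i = 0 then w j + μ * (q j).eval x
    else if i < m + 1 then (q j).eval (a (i - 1)) else (q j).coeff (i - 1) with hF
  have hFQP : natDet (n + m - k + 1) F = natDet (n + m - k + 1) Q * natDet (n + m - k + 1) P := by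
    rw [← natDet_mul]
    refine natDet_congr fun i hi j hj => ?_
    rw [Finset.sum_range_succ']
    simp only [hQ, hP, hF, Nat.add_sub_cancel, Nat.succ_ne_zero, if_false, if_true]
    split_ifs with h0 h1
    · rw [← sum_pow_mul_coeff _ _ (hqdeg j hj), Finset.mul_sum, one_mul, add_comm]
      simp only [mul_assoc]
    · rw [← sum_pow_mul_coeff _ _ (hqdeg j hj), zero_mul, add_zero]
    · rw [Finset.sum_eq_single (i - 1)]
      · rw [if_pos (by omega)]; ring
      · intro l _ hl
        rw [if_neg (by omega), zero_mul]
      · intro h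
        simp at h
        omega
  have hdetQ : natDet (n + m - k + 1) Q = natDet m (fun i j => a i ^ j) := by
    rw [show n + m - k + 1 = 1 + (m + (n - k)) by omega, natDet_add_of_lower_zero,
      natDet_add_of_lower_zero]
    · rw [natDet_eq_one_of_upperTriangular 1, one_mul, natDet_eq_one_of_upperTriangular (n - k),
        mul_one]
      · refine natDet_congr fun i hi j hj => ?_
        simp only [hQ]
        rw [if_neg (by omega), if_neg (by omega), if_pos (by omega), Nat.add_sub_cancel_left,
          Nat.add_sub_cancel_left]
      · intro i hi j hj
        simp only [hQ]
        rw [if_neg (by omega), if_neg (by omega), if_neg (by omega), if_neg (by omega)]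
      · intro i hi
        simp only [hQ]
        rw [if_neg (by omega), if_neg (by omega), if_neg (by omega), if_pos trivial]
      · intro i hi j hj
        omega
      · intro i hi
        simp only [hQ]
        rw [if_pos (by omega), if_pos (by omega)]
    · intro i hi j hj
      simp only [hQ]
      rw [if_neg (by omega), if_neg (by omega), if_neg (by omega), if_neg (by omega)]
    · intro i hi j hj
      simp only [hQ]
      rw [if_neg (by omega), if_pos (by omega)]
  have hFE : natDet (n + m - k + 1) F = natDet (m + 1) (fun i j => if i = 0 then
        (if j < k + 1 then μ * x ^ j else ν * (x ^ (j - (k + 1)) * g.eval x))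
        else (if j < k + 1 then a (i - 1) ^ j
          else a (i - 1) ^ (j - (k + 1)) * g.eval (a (i - 1)))) := by
    rw [show n + m - k + 1 = (m + 1) + (n - k) by omega, natDet_add_of_upper_zero,
      natDet_eq_one_of_upperTriangular (n - k), mul_one]
    · refine natDet_congr fun i hi j hj => ?_
      simp only [hF, hw, hq]
      split_ifs <;> simp; ring
    · intro i hi j hj
      simp only [hF, hq]
      rw [if_neg (by omega), if_neg (by omega), if_neg (by omega), if_neg (by omega)]
      exact coeff_eq_zero_of_natDegree_lt (natDegree_X_pow_mul_lt hfm (by omega))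
    · intro i hi
      simp only [hF, hq]
      rw [if_neg (by omega), if_neg (by omega), if_neg (by omega), if_neg (by omega)]
      exact Monic.coeff_X_pow_mul_self hf hfm (by omega)
    · intro i hi j hj
      simp only [hF, hw, hq, show ¬ m + 1 + j < k + 1 by omega, show ¬ m + 1 + j < m + 1 by omega,
        if_false, hi, if_true]
      split_ifs with h
      · simp
      · simp [ha (i - 1) (by omega)]
  have hdetP : natDet (n + m - k + 1) P = (-1) ^ (k + 1) *
      natDet ((n - k) + (m - k)) (subresCore f g m k x (-μ) (ν - μ)) := by
    -- Once the row `w` is moved below the coefficients of index at most `k`, the columns `1, …, x ^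
    -- k` form an identity block over zeros.
    set P' : ℕ → ℕ → R := fun l j => if l < k + 1 then (q j).coeff l
      else if l = k + 1 then w j else (q j).coeff (l - 1) with hP'
    have h1 : natDet (n + m - k + 1) P = (-1) ^ (k + 1) * natDet (n + m - k + 1) P' := by
      rw [← natDet_move_row (by omega : k + 1 < n + m - k + 1)]
      refine natDet_congr fun i hi j hj => ?_
      simp only [hP, hP']
      by_cases h0 : i = 0
      · simp [h0]
      · by_cases h2 : i ≤ k + 1
        · simp only [h0, h2, if_false, if_true]
          rw [if_pos (by omega)]
        · simp only [h0, h2, if_false]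
          rw [if_neg (by omega), if_neg (by omega)]
    rw [h1, show n + m - k + 1 = (k + 1) + ((n - k) + (m - k)) by omega, natDet_add_of_lower_zero,
      natDet_eq_one_of_upperTriangular (k + 1), one_mul]
    · congr 1
      refine natDet_congr fun i hi j hj => ?_
      simp only [hP', subresCore]
      rw [if_neg (by omega)]
      by_cases h0 : i = 0
      · simp only [h0, hw, add_zero, if_true]
        rw [if_neg (by omega)]
        by_cases h : j < m - k
        · rw [if_pos (by omega), if_pos h, Nat.add_sub_cancel_left]
        · rw [if_neg (by omega), if_neg h, show k + 1 + j - (m + 1) = j - (m - k) by omega]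
      · simp only [h0, hq, if_false]
        rw [if_neg (by omega), if_neg (by omega), show k + 1 + i - 1 = k + i by omega]
        by_cases h : j < m - k
        · rw [if_pos (by omega), if_pos h, Nat.add_sub_cancel_left]
        · rw [if_neg (by omega), if_neg h, show k + 1 + j - (m + 1) = j - (m - k) by omega]
    · intro i hi j hj
      simp only [hP', hq]
      rw [if_pos hi, if_pos (by omega), coeff_X_pow, if_neg (by omega)]
    · intro i hi
      simp only [hP', hq]
      rw [if_pos hi, if_pos hi, coeff_X_pow, if_pos rfl]
    · intro i hi j hj
      simp only [hP', hq, hw]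
      rw [if_neg (by omega), if_pos hj, if_pos hj, coeff_X_pow]
      split_ifs with h h'
      · rfl
      · omega
      · rfl
  rw [← hFE, hFQP, hdetQ, hdetP]
  ring

/-- The roots of `g` are split off first, then those of `f`; in between, the columns are rotated to
bring the plain powers in front of the multiples of `g`. -/
theorem natDet_twoBlock_eq_subresCore (f g : R[X]) {m n k : ℕ} (hf : f.Monic)
    (hg : g.Monic) (hfm : f.natDegree = m) (hgn : g.natDegree = n) (hkm : k ≤ m) (hkn : k < n)
    (z β σ : ℕ → R) (μ ν x : R) (hz : ∀ i < n, g.eval (z i) = 0)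
    (hz' : ∀ i < m, f.eval (z (n + 1 + i)) = 0)
    (hβ : ∀ i < n, β i = 1) (hσ : ∀ i < n, σ i = 0) (hx : z n = x) (hβx : β n = ν) (hσx : σ n = μ)
    (hβ' : ∀ i < m, β (n + 1 + i) = 1) (hσ' : ∀ i < m, σ (n + 1 + i) = 1) :
    natDet (n + (m + 1)) (twoBlock (n + m - k) z β σ) =
      (-1) ^ ((m - k + 1) * (k + 1)) *
      (natDet n (fun i j => z i ^ j) * natDet m (fun i j => z (n + 1 + i) ^ j)) *
        natDet ((n - k) + (m - k)) (subresCore f g m k x (-μ) (ν - μ)) := by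
  rw [natDet_twoBlock_split g hg hgn hkm z β σ hz hβ hσ]
  have h1 := natDet_roots_eq_subresCore f g hf hfm hgn hkm hkn
    (fun i => z (n + 1 + i)) hz' x μ ν
  have h2 := natDet_rotate (m - k) (k + 1) (fun i j => if i = 0 then
        (if j < k + 1 then μ * x ^ j else ν * (x ^ (j - (k + 1)) * g.eval x))
        else (if j < k + 1 then z (n + 1 + (i - 1)) ^ j
          else z (n + 1 + (i - 1)) ^ (j - (k + 1)) * g.eval (z (n + 1 + (i - 1)))))
  rw [show m - k + (k + 1) = m + 1 by omega, h1] at h2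
  rw [show (-1 : R) ^ ((m - k + 1) * (k + 1)) = (-1) ^ ((m - k) * (k + 1)) * (-1) ^ (k + 1) by
    rw [← pow_add]; congr 1; ring]
  trans natDet n (fun i j => z i ^ j) * ((-1) ^ ((m - k) * (k + 1)) * ((-1) ^ (k + 1) *
    natDet m (fun i j => z (n + 1 + i) ^ j) *
      natDet ((n - k) + (m - k)) (subresCore f g m k x (-μ) (ν - μ))))
  · rw [← h2]
    congr 1
    refine natDet_congr fun i hi j hj => ?_
    by_cases h0 : i = 0
    · by_cases h : j < m - k
      · simp [h0, h, hβx, hx, show ¬ k + 1 + j ≤ k by omega]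
      · simp only [h0, h, if_true, if_false, add_zero, hσx, hx]
        rw [if_pos (by omega)]
    · have e : n + i = n + 1 + (i - 1) := by omega
      rw [e, hβ' _ (by omega), hσ' _ (by omega)]
      by_cases h : j < m - k
      · simp [h0, h, show ¬ k + 1 + j ≤ k by omega]
      · simp only [h0, h, if_false]
        rw [if_pos (by omega), one_mul]
  · ring

end Reduction

/-! ### Identification with the subresultant matrix and its cofactors. -/

section Subresultant

variable {R : Type*} [CommRing R]

theorem coeff_X_pow_mul_eq_coeffSub (h : R[X]) {e c s j : ℕ} (hs : s + e = c + j) :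
    (X ^ e * h).coeff c = coeffSub h s j := by
  rw [coeff_X_pow_mul', coeffSub]
  by_cases hj : j ≤ s
  · rw [if_pos hj, if_pos (by omega)]
    congr 1
    omega
  · rw [if_neg hj, if_neg (by omega)]

/-- Transposition and reversal of both index orders match the two matrices. Over the base ring
`R[X]` at the point `X`, the values of `f.map C` and `g.map C` are `f` and `g` themselves. -/
theorem natDet_subresCore (f g : R[X]) {m n k : ℕ} (hkm : k ≤ m) (hkn : k ≤ n) (u v : R[X]) :
    natDet ((n - k) + (m - k)) (subresCore (f.map C) (g.map C) m k X u v) =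
      (subresMatrix f g m n k (u * f) (v * g)).det := by
  rw [← natDet_transpose, ← natDet_rev]
  unfold natDet
  congr 1
  ext1 i j
  simp only [Matrix.of_apply, subresMatrix, subresCore]
  have hj := j.2
  have hfX : (f.map C).eval X = f := by
    rw [eval_map]; exact eval₂_C_X
  have hgX : (g.map C).eval X = g := by
    rw [eval_map]; exact eval₂_C_X
  induction i using Fin.addCases with
  | left i =>
    have hi := i.2
    simp only [Fin.addCases_left, Fin.val_castAdd]
    by_cases h : (j : ℕ) + 1 = n - k + (m - k)
    · rw [if_pos h, if_pos (by omega), if_neg (by omega), hfX,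
        show n - k + (m - k) - 1 - i - (m - k) = n - k - 1 - i by omega]
      ring
    · rw [if_neg h, if_neg (by omega), if_neg (by omega), ← map_X C, ← Polynomial.map_pow,
        ← Polynomial.map_mul, coeff_map, coeff_X_pow_mul_eq_coeffSub]
      omega
  | right i =>
    have hi := i.2
    simp only [Fin.addCases_right, Fin.val_natAdd]
    by_cases h : (j : ℕ) + 1 = n - k + (m - k)
    · rw [if_pos h, if_pos (by omega), if_pos (by omega), hgX,
        show n - k + (m - k) - 1 - (n - k + i) = m - k - 1 - i by omega]
      ring
    · rw [if_neg h, if_neg (by omega), if_pos (by omega), ← map_X C, ← Polynomial.map_pow,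
        ← Polynomial.map_mul, coeff_map, coeff_X_pow_mul_eq_coeffSub]
      omega

/-- Linearity in the last column, which exists because `k < n`. -/
theorem det_subresMatrix_eq (f g : R[X]) {m n k : ℕ} (hk : k < n) (u v : R[X]) :
    (subresMatrix f g m n k u v).det = cofF f g m n k * u + cofG f g m n k * v := by
  have hN : 0 < (n - k) + (m - k) := by omega
  set l : Fin ((n - k) + (m - k)) := ⟨(n - k) + (m - k) - 1, by omega⟩ with hl
  have hcol : ∀ u v u' v' : R[X], subresMatrix f g m n k u v =
      (subresMatrix f g m n k u' v').updateCol l (fun i => subresMatrix f g m n k u v i l) := by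
    intro u v u' v'
    ext1 i j
    by_cases h : j = l
    · subst h; simp
    · rw [Matrix.updateCol_ne h]
      have : (j : ℕ) + 1 ≠ n - k + (m - k) := by
        intro h'
        apply h
        ext
        simp [hl]
        omega
      simp only [subresMatrix, Matrix.of_apply, if_neg this]
  have hsum : (fun i => subresMatrix f g m n k u v i l) =
      u • (fun i => subresMatrix f g m n k 1 0 i l) +
      v • (fun i => subresMatrix f g m n k 0 1 i l) := by
    ext1 i
    have : (l : ℕ) + 1 = n - k + (m - k) := by simp [hl]; omega
    simp only [Pi.add_apply, Pi.smul_apply, subresMatrix, Matrix.of_apply, if_pos this]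
    induction i using Fin.addCases with
    | left i => simp; ring
    | right i => simp; ring
  rw [hcol u v 1 0, hsum, Matrix.det_updateCol_add, Matrix.det_updateCol_smul,
    Matrix.det_updateCol_smul, ← hcol 1 0 1 0, ← hcol 0 1 1 0, cofF, cofG]
  ring

end Subresultant

/-! ### Laplace expansion along the two blocks of columns. -/

section Expansion

theorem card_filter_le_equiv {ι : Type*} [Fintype ι] {N L : ℕ} (e : ι ≃ Fin N) (hL : L ≤ N) :
    (Finset.univ.filter fun i : ι => L ≤ (e i : ℕ)).card = N - L := by
  have h1 : (Finset.univ.filter fun i : ι => L ≤ (e i : ℕ)).card =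
      (Finset.univ.filter fun i : Fin N => L ≤ (i : ℕ)).card :=
    Finset.card_equiv e (by simp)
  have h2 := Finset.card_filter_add_card_filter_not (s := (Finset.univ : Finset (Fin N)))
    (fun i : Fin N => (i : ℕ) < L)
  have h3 : (Finset.univ.filter fun i : Fin N => (i : ℕ) < L).card = L := by
    rw [Fin.card_filter_val_lt]
    omega
  simp only [not_lt, Finset.card_univ, Fintype.card_fin] at h2
  omega

variable {R : Type*} [CommRing R] {ι : Type*} [Fintype ι] [DecidableEq ι]

/-- The term of the Laplace expansion of `twoBlock` in which the rows in `s` are taken from the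
second block of columns and the other rows from the first. -/
def blockDet {N : ℕ} (e : ι ≃ Fin N) (L : ℕ) (z : ι → R) (s : Finset ι) : R :=
  (Matrix.of fun i j : ι => twoBlock L z (fun i => if i ∈ s then 0 else 1)
    (fun i => if i ∈ s then 1 else 0) i (e j)).det

/-- Each row is the sum of its parts in the two blocks, so multilinearity in the rows gives one term
per set of rows using the second block. -/
theorem det_twoBlock_eq_sum {N : ℕ} (e : ι ≃ Fin N) (L : ℕ) (z β σ : ι → R) :
    (Matrix.of fun i j : ι => twoBlock L z β σ i (e j)).det =
      ∑ s : Finset ι, ((∏ i ∈ s, σ i) * ∏ i ∈ sᶜ, β i) * blockDet e L z s := by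
  set u : ι → ι → R := fun i j => if (e j : ℕ) < L then 0 else z i ^ ((e j : ℕ) - L) with hu
  set w : ι → ι → R := fun i j => if (e j : ℕ) < L then z i ^ (e j : ℕ) else 0 with hw
  have h1 : (Matrix.of fun i j : ι => twoBlock L z β σ i (e j)).det =
      (Matrix.detRowAlternating (R := R) (n := ι)) ((fun i => σ i • u i) + fun i => β i • w i) := by
    change Matrix.det _ = Matrix.det _
    congr 1
    ext i j
    simp only [Matrix.of_apply, twoBlock, hu, hw, Pi.add_apply, Pi.smul_apply, smul_eq_mul]
    split_ifs <;> simp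
  rw [h1]
  refine (MultilinearMap.map_add_univ
    (Matrix.detRowAlternating (R := R) (n := ι)).toMultilinearMap _ _).trans ?_
  refine Finset.sum_congr rfl fun s _ => ?_
  have h2 : s.piecewise (fun i => σ i • u i) (fun i => β i • w i) =
      fun i => s.piecewise σ β i • s.piecewise u w i := by
    ext i j
    by_cases h : i ∈ s <;> simp [h]
  rw [h2, MultilinearMap.map_smul_univ, Finset.prod_piecewise, Finset.univ_inter, smul_eq_mul,
    ← Finset.compl_eq_univ_sdiff]
  congr 1
  change Matrix.det _ = Matrix.det _
  congr 1
  ext i j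
  by_cases h : i ∈ s <;> simp [h, hu, hw, twoBlock]

theorem blockDet_eq_zero {N : ℕ} (e : ι ≃ Fin N) {L : ℕ} (hL : L ≤ N) (z : ι → R) (s : Finset ι)
    (hs : s.card ≠ N - L) : blockDet e L z s = 0 := by
  rw [blockDet, Matrix.det_apply]
  refine Finset.sum_eq_zero fun τ _ => ?_
  obtain ⟨i, hi⟩ : ∃ i, ¬ (τ i ∈ s ↔ L ≤ (e i : ℕ)) := by
    by_contra! h
    refine hs ((Finset.card_equiv τ.symm fun i => ?_).trans (card_filter_le_equiv e hL))
    simp [← h]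
  rw [Finset.prod_eq_zero (Finset.mem_univ i), smul_zero]
  by_cases h : τ i ∈ s
  · simp [twoBlock, h]
    intro h'
    exact absurd (iff_of_true h h') hi
  · simp [twoBlock, h]
    intro h'
    exact absurd (iff_of_false h (by omega)) hi

theorem det_pow_eq_det_eval {N : ℕ} (e : ι ≃ Fin N) (z : ι → R) (p : ℕ → R[X])
    (hp : ∀ j < N, (p j).natDegree = j) (hm : ∀ j < N, (p j).Monic) :
    (Matrix.of fun i j : ι => z i ^ (e j : ℕ)).det =
      (Matrix.of fun i j : ι => (p (e j)).eval (z i)).det := by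
  have h := Matrix.det_eval_matrixOfPolynomials_eq_det_vandermonde (fun i => z (e.symm i))
    (fun j : Fin N => p j) (fun j => hp j j.2) (fun j => hm j j.2)
  rw [← Matrix.det_submatrix_equiv_self e, ← Matrix.det_submatrix_equiv_self e] at h
  convert h using 2 <;> ext i j <;> simp [Matrix.vandermonde]

/-- The full Vandermonde determinant may be computed in the basis `x ^ j` (`j < L`), `x ^ (j - L) *
h`, where `h` is monic of degree `L` with roots the points outside `s`. It is then block triangular,
and the rows in `s` contribute the factors `h (z i)`. -/
theorem blockDet_mul_prod {N : ℕ} (e : ι ≃ Fin N) {L : ℕ} (hL : L ≤ N) (z : ι → R)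
    (s : Finset ι) (hs : s.card = N - L) :
    blockDet e L z s * ∏ i ∈ s, ∏ j ∈ sᶜ, (z i - z j) =
      (Matrix.of fun i j : ι => z i ^ (e j : ℕ)).det := by
  nontriviality R
  set h : R[X] := ∏ j ∈ sᶜ, (X - C (z j)) with hh
  have hmon : h.Monic := monic_prod_of_monic _ _ fun j _ => monic_X_sub_C _
  have hcard : Fintype.card ι = N := by simpa using Fintype.card_congr e
  have hdeg : h.natDegree = L := by
    rw [hh, natDegree_prod_of_monic _ _ fun j _ => monic_X_sub_C _]
    simp only [natDegree_X_sub_C, Finset.sum_const, smul_eq_mul, mul_one, Finset.card_compl]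
    omega
  have heval : ∀ i, h.eval (z i) = ∏ j ∈ sᶜ, (z i - z j) := fun i => by
    simp [hh, eval_prod]
  rw [det_pow_eq_det_eval e z (fun j => if j < L then X ^ j else X ^ (j - L) * h)]
  · have h1 : ∏ i ∈ s, ∏ j ∈ sᶜ, (z i - z j) = ∏ i, if i ∈ s then h.eval (z i) else 1 := by
      rw [Finset.prod_ite_mem, Finset.univ_inter]
      simp only [heval]
    rw [h1, mul_comm, blockDet, ← Matrix.det_mul_column, Matrix.det_apply, Matrix.det_apply]
    refine Finset.sum_congr rfl fun τ _ => ?_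
    congr 1
    -- A permutation sending a column of the second block to a row outside `s` gives zero on both
    -- sides; by counting, any other permutation matches the second block exactly with `s`.
    by_cases hτ : ∃ i, τ i ∉ s ∧ L ≤ (e i : ℕ)
    · obtain ⟨i, hi, hiL⟩ := hτ
      rw [Finset.prod_eq_zero (Finset.mem_univ i), Finset.prod_eq_zero (Finset.mem_univ i)]
      · have : h.eval (z (τ i)) = 0 := by
          rw [heval]
          exact Finset.prod_eq_zero (Finset.mem_compl.2 hi) (sub_self _)
        simp [hiL.not_gt, this]
      · simp [twoBlock, hi, hiL.not_gt]
    · push Not at hτ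
      have hτ' : ∀ i, τ i ∈ s ↔ L ≤ (e i : ℕ) := by
        have hsub : (Finset.univ.filter fun i : ι => L ≤ (e i : ℕ)) ⊆
            Finset.univ.filter fun i => τ i ∈ s := by
          intro i hi
          simp only [Finset.mem_filter, Finset.mem_univ, true_and] at hi ⊢
          by_contra h'
          exact absurd (hτ i h') (by omega)
        have heq := Finset.eq_of_subset_of_card_le hsub (by
          rw [card_filter_le_equiv e hL, ← hs]
          exact (Finset.card_equiv τ (by simp)).le)
        intro i
        have := Finset.ext_iff.1 heq i
        simpa using this.symm
      refine Finset.prod_congr rfl fun i _ => ?_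
      by_cases hi : τ i ∈ s
      · have := (hτ' i).1 hi
        simp [hi, twoBlock, this.not_gt, mul_comm]
      · have : (e i : ℕ) < L := by
          have := (hτ' i).not.1 hi
          omega
        simp [hi, twoBlock, this]
  · intro j hj
    split_ifs with h'
    · exact natDegree_X_pow j
    · rw [Monic.natDegree_mul (monic_X_pow _) hmon, natDegree_X_pow, hdeg]
      omega
  · intro j hj
    split_ifs with h'
    · exact monic_X_pow j
    · exact (monic_X_pow _).mul hmon

theorem map_blockDet {S : Type*} [CommRing S] (φ : R →+* S) {N : ℕ} (e : ι ≃ Fin N) (L : ℕ)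
    (z : ι → R) (s : Finset ι) :
    φ (blockDet e L z s) = blockDet e L (fun i => φ (z i)) s := by
  rw [blockDet, RingHom.map_det, blockDet]
  congr 1
  ext i j
  simp only [RingHom.mapMatrix_apply, Matrix.map_apply, Matrix.of_apply, twoBlock]
  split_ifs <;> simp

/-- The `N - L` columns of the second block are supported on fewer than `N - L` rows. -/
theorem det_twoBlock_eq_zero {N : ℕ} (e : ι ≃ Fin N) {L : ℕ} (hL : L ≤ N) (z β σ : ι → R)
    (t : Finset ι) (ht : t.card < N - L) (hσ : ∀ i ∉ t, σ i = 0) :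
    (Matrix.of fun i j : ι => twoBlock L z β σ i (e j)).det = 0 := by
  rw [det_twoBlock_eq_sum]
  refine Finset.sum_eq_zero fun s _ => ?_
  by_cases hs : s.card = N - L
  · obtain ⟨i, hi, hit⟩ := Finset.exists_mem_notMem_of_card_lt_card (ht.trans_eq hs.symm)
    rw [Finset.prod_eq_zero hi (hσ i hit), zero_mul, zero_mul]
  · rw [blockDet_eq_zero e hL z s hs, mul_zero]

end Expansion

/-! ### The points `b, x, a`, their subsets and their Vandermonde determinant. -/

section Points

variable {R : Type*} [CommRing R] {m n : ℕ}

/-- The ordering of `n` points, followed by one point, followed by `m` points. -/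
def pointEquiv (m n : ℕ) : Fin n ⊕ (Fin 1 ⊕ Fin m) ≃ Fin (n + (m + 1)) :=
  ((Equiv.sumCongr (Equiv.refl _) finSumFinEquiv).trans finSumFinEquiv).trans
    (finCongr (by omega))

@[simp]
theorem pointEquiv_inl (j : Fin n) : (pointEquiv m n (Sum.inl j) : ℕ) = j := by
  simp [pointEquiv]

@[simp]
theorem pointEquiv_mid (j : Fin 1) : (pointEquiv m n (Sum.inr (Sum.inl j)) : ℕ) = n := by
  simp [pointEquiv]

@[simp]
theorem pointEquiv_inr (i : Fin m) :
    (pointEquiv m n (Sum.inr (Sum.inr i)) : ℕ) = n + 1 + i := by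
  simp [pointEquiv, add_assoc]

/-- The family with values `b` on `Fin n`, `x` on `Fin 1` and `a` on `Fin m`. -/
def points {T : Type*} (b : Fin n → T) (x : T) (a : Fin m → T) : Fin n ⊕ (Fin 1 ⊕ Fin m) → T :=
  Sum.elim b (Sum.elim (fun _ => x) a)

/-- A subset of the index set of `points` given by its three parts. -/
def triple (B' : Finset (Fin n)) (x' : Finset (Fin 1)) (A' : Finset (Fin m)) :
    Finset (Fin n ⊕ (Fin 1 ⊕ Fin m)) :=
  B'.disjSum (x'.disjSum A')

theorem triple_compl (B' : Finset (Fin n)) (x' : Finset (Fin 1)) (A' : Finset (Fin m)) :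
    (triple B' x' A')ᶜ = triple B'ᶜ x'ᶜ A'ᶜ := by
  ext i
  rcases i with i | i | i <;> simp [triple]

theorem card_triple (B' : Finset (Fin n)) (x' : Finset (Fin 1)) (A' : Finset (Fin m)) :
    (triple B' x' A').card = B'.card + (x'.card + A'.card) := by
  simp [triple]

theorem prod_triple (B' : Finset (Fin n)) (x' : Finset (Fin 1)) (A' : Finset (Fin m))
    (h : Fin n ⊕ (Fin 1 ⊕ Fin m) → R) :
    ∏ i ∈ triple B' x' A', h i = (∏ i ∈ B', h (Sum.inl i)) *
      ((∏ i ∈ x', h (Sum.inr (Sum.inl i))) * ∏ i ∈ A', h (Sum.inr (Sum.inr i))) := by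
  simp [triple, Finset.prod_disjSum]

theorem sum_finset_points (h : Finset (Fin n ⊕ (Fin 1 ⊕ Fin m)) → R) :
    ∑ s, h s = ∑ A' : Finset (Fin m), ∑ B' : Finset (Fin n),
      (h (triple B' ∅ A') + h (triple B' Finset.univ A')) := by
  have h1 : ∑ s, h s = ∑ B' : Finset (Fin n), ∑ t : Finset (Fin 1 ⊕ Fin m), h (B'.disjSum t) := by
    rw [← Fintype.sum_prod_type' (fun B' t => h (Finset.disjSum B' t))]
    exact (Fintype.sum_equiv Finset.sumEquiv.symm.toEquiv _ _ fun _ => rfl).symm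
  have h2 : ∀ h' : Finset (Fin 1 ⊕ Fin m) → R, ∑ t, h' t =
      ∑ x' : Finset (Fin 1), ∑ A' : Finset (Fin m), h' (x'.disjSum A') := by
    intro h'
    rw [← Fintype.sum_prod_type' (fun x' A' => h' (Finset.disjSum x' A'))]
    exact (Fintype.sum_equiv Finset.sumEquiv.symm.toEquiv _ _ fun _ => rfl).symm
  have h3 : ∀ h' : Finset (Fin 1) → R, ∑ x', h' x' = h' ∅ + h' Finset.univ := by
    intro h'
    rw [show (Finset.univ : Finset (Finset (Fin 1))) = {∅, Finset.univ} by decide,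
      Finset.sum_pair (by decide)]
  simp only [h1, h2, h3, ← Finset.sum_add_distrib]
  exact Finset.sum_comm

/-- The extension by zero to `ℕ` of a family indexed by a finite set of points. -/
def extend (h : Fin n ⊕ (Fin 1 ⊕ Fin m) → R) (i : ℕ) : R :=
  if hi : i < n + (m + 1) then h ((pointEquiv m n).symm ⟨i, hi⟩) else 0

theorem extend_pointEquiv (h : Fin n ⊕ (Fin 1 ⊕ Fin m) → R) (i) :
    extend h (pointEquiv m n i) = h i := by
  simp [extend]

theorem extend_points_left (b : Fin n → R) (x : R) (a : Fin m → R) (i : Fin n) :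
    extend (points b x a) i = b i := by
  rw [← pointEquiv_inl (m := m), extend_pointEquiv]
  rfl

theorem extend_points_mid (b : Fin n → R) (x : R) (a : Fin m → R) :
    extend (points b x a) n = x := by
  have h := extend_pointEquiv (points b x a) (Sum.inr (Sum.inl 0))
  rwa [pointEquiv_mid] at h

theorem extend_points_right (b : Fin n → R) (x : R) (a : Fin m → R) (i : Fin m) :
    extend (points b x a) (n + 1 + i) = a i := by
  rw [← pointEquiv_inr, extend_pointEquiv]
  rfl

theorem det_pointEquiv_eq_natDet (M : ℕ → ℕ → R) :
    (Matrix.of fun i j => M (pointEquiv m n i) (pointEquiv m n j)).det =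
      natDet (n + (m + 1)) M := by
  rw [natDet, ← Matrix.det_submatrix_equiv_self (pointEquiv m n)]
  rfl

theorem det_twoBlock_eq_natDet (L : ℕ) (z β σ : Fin n ⊕ (Fin 1 ⊕ Fin m) → R) :
    (Matrix.of fun i j => twoBlock L z β σ i (pointEquiv m n j)).det =
      natDet (n + (m + 1)) (twoBlock L (extend z) (extend β) (extend σ)) := by
  rw [← det_pointEquiv_eq_natDet]
  simp only [twoBlock, extend_pointEquiv]

/-- Column `l` is subtracted from column `l + L`; `N ≤ 2 * L` ensures that the subtracted column
always lies in the first block. -/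
theorem natDet_twoBlock_sub (L N : ℕ) (hN : N ≤ 2 * L) (z β σ : ℕ → R) :
    natDet N (twoBlock L z β σ) = natDet N (twoBlock L z β (fun i => σ i - β i)) := by
  have h1 : natDet N (fun l j => (if l = j then 1 else 0) -
      if l + L = j then (1 : R) else 0) = 1 := by
    refine natDet_eq_one_of_upperTriangular _ _ (fun i _ j hj => ?_) (fun i hi => ?_)
    · rw [if_neg (by omega), if_neg (by omega), sub_zero]
    · rw [if_pos rfl, if_neg (by omega), sub_zero]
  rw [← mul_one (natDet N (twoBlock L z β σ)), ← h1, ← natDet_mul]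
  refine natDet_congr fun i hi j hj => ?_
  simp only [mul_sub, mul_ite, mul_one, mul_zero, Finset.sum_sub_distrib]
  rw [Finset.sum_ite_eq' , if_pos (Finset.mem_range.2 hj)]
  by_cases h : j < L
  · rw [Finset.sum_eq_zero, sub_zero]
    · simp [twoBlock, h]
    · intro l _
      rw [if_neg (by omega)]
  · rw [Finset.sum_eq_single (j - L)]
    · rw [if_pos (by omega)]
      simp only [twoBlock, h, if_false]
      rw [if_pos (by omega)]
      ring
    · intro l _ hl
      rw [if_neg (by omega)]
    · intro h'
      simp at h'
      omega

theorem det_twoBlock_points (L : ℕ) (b : Fin n → R) (x : R) (a : Fin m → R)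
    (σB σx σA βx : R) :
    (Matrix.of fun i j => twoBlock L (points b x a) (points 1 βx 1)
        (points (fun _ => σB) σx (fun _ => σA)) i (pointEquiv m n j)).det =
      ∑ A' : Finset (Fin m), ∑ B' : Finset (Fin n), σB ^ B'.card * σA ^ A'.card *
        (βx * blockDet (pointEquiv m n) L (points b x a) (triple B' ∅ A') +
          σx * blockDet (pointEquiv m n) L (points b x a) (triple B' Finset.univ A')) := by
  rw [det_twoBlock_eq_sum, sum_finset_points]
  refine Finset.sum_congr rfl fun A' _ => Finset.sum_congr rfl fun B' _ => ?_
  simp only [triple_compl, prod_triple, Finset.compl_univ]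
  simp [points]
  ring

/-- `∏_{i ∈ Y, j ∈ Z} (u i - v j)`. -/
def crossProd {α β : Type*} (Y : Finset α) (Z : Finset β) (u : α → R) (v : β → R) : R :=
  ∏ i ∈ Y, ∏ j ∈ Z, (u i - v j)

theorem crossProd_swap {α β : Type*} (Y : Finset α) (Z : Finset β) (u : α → R) (v : β → R) :
    crossProd Y Z u v = (-1) ^ (Y.card * Z.card) * crossProd Z Y v u := by
  rw [crossProd, crossProd, Finset.prod_comm]
  have : ∀ j ∈ Z, ∏ i ∈ Y, (u i - v j) = (-1) ^ Y.card * ∏ i ∈ Y, (v j - u i) := by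
    intro j _
    rw [← Finset.prod_const, ← Finset.prod_mul_distrib]
    exact Finset.prod_congr rfl fun i _ => by ring
  rw [Finset.prod_congr rfl this, Finset.prod_mul_distrib, Finset.prod_const, ← pow_mul]

theorem crossProd_univ_left {α β : Type*} [Fintype α] [DecidableEq α] (Y : Finset α)
    (Z : Finset β) (u : α → R) (v : β → R) :
    crossProd Finset.univ Z u v = crossProd Y Z u v * crossProd Yᶜ Z u v :=
  (Finset.prod_mul_prod_compl Y _).symm

theorem crossProd_univ_right {α β : Type*} [Fintype β] [DecidableEq β] (Y : Finset α)
    (Z : Finset β) (u : α → R) (v : β → R) :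
    crossProd Y Finset.univ u v = crossProd Y Z u v * crossProd Y Zᶜ u v := by
  simp only [crossProd, ← Finset.prod_mul_distrib]
  exact Finset.prod_congr rfl fun i _ => (Finset.prod_mul_prod_compl Z _).symm

theorem map_crossProd {S : Type*} [CommRing S] (φ : R →+* S) {α β : Type*} (Y : Finset α)
    (Z : Finset β) (u : α → R) (v : β → R) :
    φ (crossProd Y Z u v) = crossProd Y Z (fun i => φ (u i)) (fun j => φ (v j)) := by
  simp [crossProd]

theorem natDet_pow_add (c d : ℕ) (z : ℕ → R) :
    natDet (c + d) (fun i j => z i ^ j) = natDet c (fun i j => z i ^ j) *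
      natDet d (fun i j => z (c + i) ^ j) *
      ∏ i ∈ Finset.range d, ∏ j ∈ Finset.range c, (z (c + i) - z j) := by
  nontriviality R
  set g : R[X] := ∏ j ∈ Finset.range c, (X - C (z j)) with hg
  have hmon : g.Monic := monic_prod_of_monic _ _ fun j _ => monic_X_sub_C _
  have hdeg : g.natDegree = c := by
    rw [hg, natDegree_prod_of_monic _ _ fun j _ => monic_X_sub_C _]
    simp
  have heval : ∀ i, g.eval (z i) = ∏ j ∈ Finset.range c, (z i - z j) := fun i => by
    simp [hg, eval_prod]
  have h1 : natDet (c + d) (fun i j => z i ^ j) =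
      natDet (c + d) (fun i j => (if j < c then X ^ j else X ^ (j - c) * g).eval (z i)) := by
    refine det_pow_eq_det_eval (Equiv.refl (Fin (c + d))) (fun i => z i)
      (fun j => if j < c then X ^ j else X ^ (j - c) * g) ?_ ?_
    · intro j hj
      split_ifs with h'
      · exact natDegree_X_pow j
      · rw [Monic.natDegree_mul (monic_X_pow _) hmon, natDegree_X_pow, hdeg]
        omega
    · intro j hj
      split_ifs with h'
      · exact monic_X_pow j
      · exact (monic_X_pow _).mul hmon
  rw [h1, natDet_add_of_upper_zero, mul_assoc]
  · congr 1
    · refine natDet_congr fun i hi j hj => ?_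
      simp [hj]
    · simp only [← heval]
      rw [mul_comm, Finset.prod_range]
      unfold natDet
      rw [← Matrix.det_mul_column]
      congr 1
      ext i j
      simp [mul_comm]
  · intro i hi j hj
    rw [if_neg (by omega), eval_mul, heval,
      Finset.prod_eq_zero (Finset.mem_range.2 hi) (sub_self _), mul_zero]

theorem natDet_pow_eq_vandermonde {c : ℕ} (v : Fin c → R) (z : ℕ → R) (h : ∀ i : Fin c, z i = v i) :
    natDet c (fun i j => z i ^ j) = (Matrix.vandermonde v).det := by
  unfold natDet
  congr 1
  ext i j
  simp [Matrix.vandermonde, h]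

theorem det_pow_points (b : Fin n → R) (x : R) (a : Fin m → R) :
    (Matrix.of fun i j => points b x a i ^ (pointEquiv m n j : ℕ)).det =
      (Matrix.vandermonde b).det * (Matrix.vandermonde a).det *
      (crossProd Finset.univ Finset.univ a b *
        (crossProd (Finset.univ : Finset (Fin m)) (Finset.univ : Finset (Fin 1)) a (fun _ => x) *
        crossProd (Finset.univ : Finset (Fin 1)) (Finset.univ : Finset (Fin n)) (fun _ => x) b)) := by
  have h1 := det_pointEquiv_eq_natDet (m := m) (n := n)
    (fun i j => extend (points b x a) i ^ j)
  simp only [extend_pointEquiv] at h1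
  rw [h1, natDet_pow_add, natDet_pow_eq_vandermonde b _ (extend_points_left b x a),
    show m + 1 = 1 + m by omega, natDet_pow_add]
  simp only [← add_assoc]
  rw [natDet_pow_eq_vandermonde a (fun i => extend (points b x a) (n + 1 + i))
      (extend_points_right b x a),
    natDet_eq_one_of_upperTriangular 1 _ (fun i hi j hj => by omega) (fun i hi => by
      rw [Nat.lt_one_iff.1 hi, pow_zero]),
    show 1 + m = m + 1 by omega, Finset.prod_range_succ']
  simp only [Finset.prod_range, ← add_assoc, add_zero, extend_points_left, extend_points_mid,
    show ∀ i, n + i + 1 = n + 1 + i by intro i; omega, extend_points_right, crossProd]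
  simp [extend_points_mid]
  ring

end Points

/-! ### Laplace terms as summands of the double sum. -/

section Terms

variable {R : Type*} [CommRing R] {m n : ℕ}

theorem crossProd_ne_zero [IsDomain R] {α β : Type*} {Y : Finset α} {Z : Finset β} {u : α → R}
    {v : β → R} (h : ∀ i ∈ Y, ∀ j ∈ Z, u i ≠ v j) : crossProd Y Z u v ≠ 0 :=
  Finset.prod_ne_zero_iff.2 fun i hi => Finset.prod_ne_zero_iff.2 fun j hj =>
    sub_ne_zero.2 (h i hi j hj)

@[simp]
theorem crossProd_empty_left {α β : Type*} (Z : Finset β) (u : α → R) (v : β → R) :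
    crossProd ∅ Z u v = 1 := by
  simp [crossProd]

@[simp]
theorem crossProd_empty_right {α β : Type*} (Y : Finset α) (u : α → R) (v : β → R) :
    crossProd Y (∅ : Finset β) u v = 1 := by
  simp [crossProd]

theorem prod_triple_triple (B₁ B₂ : Finset (Fin n)) (x₁ x₂ : Finset (Fin 1))
    (A₁ A₂ : Finset (Fin m)) (b : Fin n → R) (x : R) (a : Fin m → R) :
    ∏ i ∈ triple B₁ x₁ A₁, ∏ j ∈ triple B₂ x₂ A₂, (points b x a i - points b x a j) =
      (crossProd B₁ B₂ b b * crossProd B₁ x₂ b (fun _ => x) * crossProd B₁ A₂ b a) *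
      (crossProd x₁ B₂ (fun _ => x) b * crossProd x₁ x₂ (fun _ => x) (fun _ => x) *
        crossProd x₁ A₂ (fun _ => x) a) *
      (crossProd A₁ B₂ a b * crossProd A₁ x₂ a (fun _ => x) * crossProd A₁ A₂ a a) := by
  simp only [prod_triple, points, Sum.elim_inl, Sum.elim_inr, Finset.prod_mul_distrib, crossProd]
  ring

/-- In `blockDet_mul_prod`, both sides are split along `A'`, `B'` and their complements. The factors
common to both sides are nonzero for distinct points of a domain, and cancelling them leaves the
numerator and denominator of the double sum. -/
theorem blockDet_triple_univ_of_injective [IsDomain R] {L : ℕ} (hL : L ≤ n + (m + 1))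
    (b : Fin n → R) (x : R) (a : Fin m → R) (hz : Function.Injective (points b x a))
    (B' : Finset (Fin n)) (A' : Finset (Fin m))
    (hc : B'.card + (1 + A'.card) = n + (m + 1) - L) :
    blockDet (pointEquiv m n) L (points b x a) (triple B' Finset.univ A') *
      (crossProd A' A'ᶜ a a * crossProd B' B'ᶜ b b) =
    (-1) ^ (m + (m - A'.card) * B'.card) *
      ((Matrix.vandermonde b).det * (Matrix.vandermonde a).det) *
      (crossProd (Finset.univ : Finset (Fin 1)) A' (fun _ => x) a *
        crossProd (Finset.univ : Finset (Fin 1)) B' (fun _ => x) b *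
        (crossProd A' B' a b * crossProd A'ᶜ B'ᶜ a b)) := by
  have hT := blockDet_mul_prod (pointEquiv m n) hL (points b x a) (triple B' Finset.univ A')
    (by rw [card_triple]; simpa using hc)
  have hab : ∀ i j, a i ≠ b j := fun i j h => by
    simpa using @hz (Sum.inr (Sum.inr i)) (Sum.inl j) h
  have hxa : ∀ i, x ≠ a i := fun i h => by
    simpa using @hz (Sum.inr (Sum.inl 0)) (Sum.inr (Sum.inr i)) h
  have hxb : ∀ j, x ≠ b j := fun j h => by
    simpa using @hz (Sum.inr (Sum.inl 0)) (Sum.inl j) h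
  rw [det_pow_points, triple_compl, prod_triple_triple, Finset.compl_univ] at hT
  simp only [crossProd_empty_right, mul_one] at hT
  rw [crossProd_univ_left A' Finset.univ a b, crossProd_univ_right A' B', crossProd_univ_right A'ᶜ B',
    crossProd_swap Finset.univ Finset.univ a,
    crossProd_univ_right _ A', crossProd_univ_right _ B' (fun _ => x),
    crossProd_swap B' A'ᶜ b a, Finset.card_compl] at hT
  simp only [Finset.card_univ, Fintype.card_fin, mul_one] at hT
  have h1 : crossProd A' B'ᶜ a b ≠ 0 := crossProd_ne_zero fun i _ j _ => hab i j
  have h2 : crossProd A'ᶜ B' a b ≠ 0 := crossProd_ne_zero fun i _ j _ => hab i j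
  have h3 : crossProd (Finset.univ : Finset (Fin 1)) A'ᶜ (fun _ => x) a ≠ 0 :=
    crossProd_ne_zero fun i _ j _ => hxa j
  have h4 : crossProd (Finset.univ : Finset (Fin 1)) B'ᶜ (fun _ => x) b ≠ 0 :=
    crossProd_ne_zero fun i _ j _ => hxb j
  refine mul_right_cancel₀ (mul_ne_zero (mul_ne_zero h1 h2) (mul_ne_zero h3 h4)) ?_
  have hs : ((-1 : R) ^ ((m - A'.card) * B'.card)) * (-1) ^ (B'.card * (m - A'.card)) = 1 := by
    rw [mul_comm B'.card, ← mul_pow]; simp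
  rw [pow_add]
  linear_combination (-1 : R) ^ ((m - A'.card) * B'.card) * hT -
    blockDet (pointEquiv m n) L (points b x a) (triple B' Finset.univ A') *
      (crossProd A' A'ᶜ a a * crossProd B' B'ᶜ b b) * (crossProd A' B'ᶜ a b * crossProd A'ᶜ B' a b *
      (crossProd (Finset.univ : Finset (Fin 1)) A'ᶜ (fun _ => x) a *
       crossProd (Finset.univ : Finset (Fin 1)) B'ᶜ (fun _ => x) b)) * hs

/-- Here `x` uses the first block, so `A'` and `B'` are the rows of the first block and their
complements those of the second. -/
theorem blockDet_triple_empty_of_injective [IsDomain R] {L : ℕ} (hL : L ≤ n + (m + 1))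
    (b : Fin n → R) (x : R) (a : Fin m → R) (hz : Function.Injective (points b x a))
    (B' : Finset (Fin n)) (A' : Finset (Fin m))
    (hc : B'ᶜ.card + A'ᶜ.card = n + (m + 1) - L) :
    blockDet (pointEquiv m n) L (points b x a) (triple B'ᶜ ∅ A'ᶜ) *
      (crossProd A' A'ᶜ a a * crossProd B' B'ᶜ b b) =
    (-1) ^ (A'.card + (n - B'.card) + A'.card * (n - B'.card) + A'.card * (m - A'.card) +
        B'.card * (n - B'.card)) *
      ((Matrix.vandermonde b).det * (Matrix.vandermonde a).det) *
      (crossProd (Finset.univ : Finset (Fin 1)) A' (fun _ => x) a *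
        crossProd (Finset.univ : Finset (Fin 1)) B' (fun _ => x) b *
        (crossProd A' B' a b * crossProd A'ᶜ B'ᶜ a b)) := by
  have hT := blockDet_mul_prod (pointEquiv m n) hL (points b x a) (triple B'ᶜ ∅ A'ᶜ)
    (by rw [card_triple]; simpa using hc)
  have hab : ∀ i j, a i ≠ b j := fun i j h => by
    simpa using @hz (Sum.inr (Sum.inr i)) (Sum.inl j) h
  have hxa : ∀ i, x ≠ a i := fun i h => by
    simpa using @hz (Sum.inr (Sum.inl 0)) (Sum.inr (Sum.inr i)) h
  have hxb : ∀ j, x ≠ b j := fun j h => by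
    simpa using @hz (Sum.inr (Sum.inl 0)) (Sum.inl j) h
  rw [det_pow_points, triple_compl, prod_triple_triple, Finset.compl_empty] at hT
  simp only [crossProd_empty_left, mul_one, compl_compl] at hT
  rw [crossProd_univ_left A' Finset.univ a b, crossProd_univ_right A' B', crossProd_univ_right A'ᶜ B',
    crossProd_univ_left A' Finset.univ, crossProd_univ_right _ B' (fun _ => x),
    crossProd_swap B'ᶜ A' b a, crossProd_swap B'ᶜ B' b b, crossProd_swap A'ᶜ A' a a,
    crossProd_swap A' Finset.univ a, crossProd_swap B'ᶜ Finset.univ b, Finset.card_compl,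
    Finset.card_compl] at hT
  simp only [Finset.card_univ, Fintype.card_fin, mul_one] at hT
  have h1 : crossProd A' B'ᶜ a b ≠ 0 := crossProd_ne_zero fun i _ j _ => hab i j
  have h2 : crossProd A'ᶜ B' a b ≠ 0 := crossProd_ne_zero fun i _ j _ => hab i j
  have h3 : crossProd A'ᶜ (Finset.univ : Finset (Fin 1)) a (fun _ => x) ≠ 0 :=
    crossProd_ne_zero fun i _ j _ => (hxa i).symm
  have h4 : crossProd (Finset.univ : Finset (Fin 1)) B'ᶜ (fun _ => x) b ≠ 0 :=
    crossProd_ne_zero fun i _ j _ => hxb j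
  refine mul_right_cancel₀ (mul_ne_zero (mul_ne_zero h1 h2) (mul_ne_zero h3 h4)) ?_
  have hsq : ∀ c : ℕ, (-1 : R) ^ c * (-1) ^ c = 1 := fun c => by rw [← mul_pow]; simp
  have hs : ((-1 : R) ^ (n - B'.card) * (-1) ^ ((n - B'.card) * A'.card) *
      (-1) ^ ((m - A'.card) * A'.card) * (-1) ^ ((n - B'.card) * B'.card)) *
      ((-1) ^ (n - B'.card) * (-1) ^ ((n - B'.card) * A'.card) *
      (-1) ^ ((m - A'.card) * A'.card) * (-1) ^ ((n - B'.card) * B'.card)) = 1 := by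
    rw [← pow_add, ← pow_add, ← pow_add, hsq]
  rw [pow_add, pow_add, pow_add, pow_add, mul_comm A'.card (n - B'.card),
    mul_comm A'.card (m - A'.card), mul_comm B'.card (n - B'.card)]
  linear_combination ((-1 : R) ^ (n - B'.card) * (-1) ^ ((n - B'.card) * A'.card) *
      (-1) ^ ((m - A'.card) * A'.card) * (-1) ^ ((n - B'.card) * B'.card)) * hT -
    blockDet (pointEquiv m n) L (points b x a) (triple B'ᶜ ∅ A'ᶜ) *
      (crossProd A' A'ᶜ a a * crossProd B' B'ᶜ b b) * (crossProd A' B'ᶜ a b * crossProd A'ᶜ B' a b *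
      (crossProd A'ᶜ (Finset.univ : Finset (Fin 1)) a (fun _ => x) *
       crossProd (Finset.univ : Finset (Fin 1)) B'ᶜ (fun _ => x) b)) * hs

/-- Distinct indeterminates, as a family of points. -/
theorem points_X_injective :
    Function.Injective (points (n := n) (m := m)
      (fun j => (MvPolynomial.X (Sum.inl j) : MvPolynomial (Fin n ⊕ (Fin 1 ⊕ Fin m)) ℤ))
      (MvPolynomial.X (Sum.inr (Sum.inl 0))) (fun i => MvPolynomial.X (Sum.inr (Sum.inr i)))) := by
  have h : points (n := n) (m := m)
      (fun j => (MvPolynomial.X (Sum.inl j) : MvPolynomial (Fin n ⊕ (Fin 1 ⊕ Fin m)) ℤ))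
      (MvPolynomial.X (Sum.inr (Sum.inl 0))) (fun i => MvPolynomial.X (Sum.inr (Sum.inr i))) =
      MvPolynomial.X := by
    ext1 i
    rcases i with i | i | i
    · rfl
    · rw [Subsingleton.elim i 0]; rfl
    · rfl
  rw [h]
  exact MvPolynomial.X_injective

theorem map_det_vandermonde {S : Type*} [CommRing S] (φ : R →+* S) {c : ℕ} (v : Fin c → R) :
    φ (Matrix.vandermonde v).det = (Matrix.vandermonde fun i => φ (v i)).det := by
  rw [RingHom.map_det]
  congr 1
  ext i j
  simp [Matrix.vandermonde]

theorem map_points {T S : Type*} (φ : T → S) (b : Fin n → T) (x : T) (a : Fin m → T) :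
    (fun i => φ (points b x a i)) = points (fun j => φ (b j)) (φ x) (fun i => φ (a i)) := by
  ext1 i
  rcases i with i | i | i <;> rfl

theorem eval_points_X (b : Fin n → R) (x : R) (a : Fin m → R) :
    (fun i => MvPolynomial.eval₂Hom (Int.castRingHom R) (points b x a)
      (points (n := n) (m := m) (fun j => MvPolynomial.X (Sum.inl j))
      (MvPolynomial.X (Sum.inr (Sum.inl 0))) (fun i => MvPolynomial.X (Sum.inr (Sum.inr i))) i)) =
      points b x a := by
  ext1 i
  rcases i with i | i | i <;> simp [points]

/-- A polynomial identity over `ℤ` in the points, hence a specialization of the case of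
indeterminates. This matters because `A` and `B` may intersect, so that the cancelled factors `a i -
b j` may vanish. -/
theorem blockDet_triple_univ {L : ℕ} (hL : L ≤ n + (m + 1)) (b : Fin n → R) (x : R)
    (a : Fin m → R) (B' : Finset (Fin n)) (A' : Finset (Fin m))
    (hc : B'.card + (1 + A'.card) = n + (m + 1) - L) :
    blockDet (pointEquiv m n) L (points b x a) (triple B' Finset.univ A') *
      (crossProd A' A'ᶜ a a * crossProd B' B'ᶜ b b) =
    (-1) ^ (m + (m - A'.card) * B'.card) *
      ((Matrix.vandermonde b).det * (Matrix.vandermonde a).det) *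
      (crossProd (Finset.univ : Finset (Fin 1)) A' (fun _ => x) a *
        crossProd (Finset.univ : Finset (Fin 1)) B' (fun _ => x) b *
        (crossProd A' B' a b * crossProd A'ᶜ B'ᶜ a b)) := by
  have h := congrArg (MvPolynomial.eval₂Hom (Int.castRingHom R) (points b x a))
    (blockDet_triple_univ_of_injective hL _ _ _ (points_X_injective (n := n) (m := m)) B' A' hc)
  simp only [map_mul, map_pow, map_neg, map_one, map_blockDet, map_crossProd,
    map_det_vandermonde, eval_points_X] at h
  simpa only [MvPolynomial.coe_eval₂Hom, MvPolynomial.eval₂_X, points, Sum.elim_inl,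
    Sum.elim_inr] using h

theorem blockDet_triple_empty {L : ℕ} (hL : L ≤ n + (m + 1)) (b : Fin n → R) (x : R)
    (a : Fin m → R) (B' : Finset (Fin n)) (A' : Finset (Fin m))
    (hc : B'ᶜ.card + A'ᶜ.card = n + (m + 1) - L) :
    blockDet (pointEquiv m n) L (points b x a) (triple B'ᶜ ∅ A'ᶜ) *
      (crossProd A' A'ᶜ a a * crossProd B' B'ᶜ b b) =
    (-1) ^ (A'.card + (n - B'.card) + A'.card * (n - B'.card) + A'.card * (m - A'.card) +
        B'.card * (n - B'.card)) *
      ((Matrix.vandermonde b).det * (Matrix.vandermonde a).det) *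
      (crossProd (Finset.univ : Finset (Fin 1)) A' (fun _ => x) a *
        crossProd (Finset.univ : Finset (Fin 1)) B' (fun _ => x) b *
        (crossProd A' B' a b * crossProd A'ᶜ B'ᶜ a b)) := by
  have h := congrArg (MvPolynomial.eval₂Hom (Int.castRingHom R) (points b x a))
    (blockDet_triple_empty_of_injective hL _ _ _ (points_X_injective (n := n) (m := m)) B' A' hc)
  simp only [map_mul, map_pow, map_neg, map_one, map_blockDet, map_crossProd,
    map_det_vandermonde, eval_points_X] at h
  simpa only [MvPolynomial.coe_eval₂Hom, MvPolynomial.eval₂_X, points, Sum.elim_inl,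
    Sum.elim_inr] using h

end Terms

/-! ### The generating polynomial in `t` and its coefficients. -/

section Generating

variable {R : Type*} [CommRing R] {m n : ℕ}

/-- The determinant with rows `(V | 0)` at `b`, `(V | V)` at `a` and `(ν V | μ V)` at `x`, where
the first block has `L` columns. -/
def reducedDet (L : ℕ) (b : Fin n → R) (x : R) (a : Fin m → R) (ν μ : R) : R :=
  (Matrix.of fun i j => twoBlock L (points b x a) (points 1 ν 1)
    (points (fun _ => 0) μ (fun _ => 1)) i (pointEquiv m n j)).det

/-- The weight `0` on `b` forces `B' = ∅`. The second block then takes `k` rows of `a` together with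
`x`, or `k + 1` rows of `a` without it. -/
theorem det_twoBlock_scaled {k : ℕ} (hk : k ≤ n + m) (b : Fin n → R) (x : R)
    (a : Fin m → R) (ν μ lam : R) :
    (Matrix.of fun i j => twoBlock (n + m - k) (points b x a) (points 1 ν 1)
      (points (fun _ => 0) μ (fun _ => lam)) i (pointEquiv m n j)).det =
    lam ^ k * (μ * reducedDet (n + m - k) b x a 0 1) +
      lam ^ (k + 1) * (ν * reducedDet (n + m - k) b x a 1 0) := by
  simp only [reducedDet, det_twoBlock_points, Finset.mul_sum, ← Finset.sum_add_distrib]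
  refine Finset.sum_congr rfl fun A' _ => Finset.sum_congr rfl fun B' _ => ?_
  by_cases hB : B' = ∅
  · subst hB
    have hz : ∀ (x' : Finset (Fin 1)), x'.card + A'.card ≠ k + 1 →
        blockDet (pointEquiv m n) (n + m - k) (points b x a) (triple ∅ x' A') = 0 := fun x' hx' =>
      blockDet_eq_zero _ (by omega) _ _ (by
        rw [card_triple, Finset.card_empty]
        omega)
    have h0 := hz ∅
    have h1 := hz Finset.univ
    simp only [Finset.card_empty, Finset.card_univ, Fintype.card_fin] at h0 h1 ⊢
    by_cases hA : A'.card = k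
    · rw [h0 (by omega), hA]; ring
    · rw [h1 (by omega)]
      by_cases hA' : A'.card = k + 1
      · rw [hA']; ring
      · rw [h0 (by omega)]; ring
  · have : B'.card ≠ 0 := by simpa using hB
    simp [zero_pow this]

theorem det_twoBlock_generating {k : ℕ} (hk : 2 * k + 1 ≤ n + m) (b : Fin n → R) (x : R)
    (a : Fin m → R) (d c t : R) :
    ∑ A' : Finset (Fin m), ∑ B' : Finset (Fin n), t ^ A'.card *
        (d * blockDet (pointEquiv m n) (n + m - k) (points b x a) (triple B' ∅ A') +
          c * blockDet (pointEquiv m n) (n + m - k) (points b x a) (triple B' Finset.univ A')) =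
    (t - 1) ^ k * ((c - d) * reducedDet (n + m - k) b x a 0 1) +
      (t - 1) ^ (k + 1) * (d * reducedDet (n + m - k) b x a 1 0) := by
  have h1 := det_twoBlock_points (n + m - k) b x a 1 c t d
  simp only [one_pow, one_mul] at h1
  rw [← h1, ← det_twoBlock_scaled (by omega), det_twoBlock_eq_natDet,
    natDet_twoBlock_sub _ _ (by omega), det_twoBlock_eq_natDet]
  congr 2
  ext1 i
  simp only [extend]
  split_ifs with h
  · rcases (pointEquiv m n).symm ⟨i, h⟩ with i | i | i <;> simp [points]
  · simp

theorem sum_blockDet_coeff {k : ℕ} (hk : 2 * k + 1 ≤ n + m) (b : Fin n → R) (x : R)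
    (a : Fin m → R) (d c : R) (p : ℕ) :
    ∑ A' ∈ (Finset.univ : Finset (Fin m)).powersetCard p, ∑ B' : Finset (Fin n),
        (d * blockDet (pointEquiv m n) (n + m - k) (points b x a) (triple B' ∅ A') +
          c * blockDet (pointEquiv m n) (n + m - k) (points b x a) (triple B' Finset.univ A')) =
    (-1) ^ (k - p) * k.choose p * ((c - d) * reducedDet (n + m - k) b x a 0 1) +
      (-1) ^ (k + 1 - p) * (k + 1).choose p * (d * reducedDet (n + m - k) b x a 1 0) := by
  -- The parameter `t` becomes the indeterminate of `R[X]` while all other data are constants, so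
  -- the coefficient at `p` selects `A'.card = p`.
  have h := det_twoBlock_generating hk (fun j => C (b j)) (C x) (fun i => C (a i)) (C d) (C c) X
  have hr : ∀ ν μ : R, reducedDet (n + m - k) (fun j => C (b j)) (C x) (fun i => C (a i))
      (C ν) (C μ) = C (reducedDet (n + m - k) b x a ν μ) := by
    intro ν μ
    rw [reducedDet, reducedDet, RingHom.map_det]
    congr 1
    ext1 i j
    simp only [RingHom.mapMatrix_apply, Matrix.map_apply, Matrix.of_apply, twoBlock]
    rcases i with i | i | i <;> split_ifs <;> simp [points]
  rw [show (0 : R[X]) = C 0 by simp, show (1 : R[X]) = C 1 by simp] at h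
  simp only [hr, ← map_points (fun r => (C r : R[X])), ← map_blockDet (C : R →+* R[X])] at h
  have hX : ∀ r : ℕ, ((X - C (1 : R)) ^ r).coeff p = (-1) ^ (r - p) * (r.choose p : R) := fun r => by
    rw [sub_eq_add_neg, ← C_neg, coeff_X_add_C_pow]
  have h' := congrArg (fun P : R[X] => P.coeff p) h
  simp only [finsetSum_coeff, coeff_add, ← C_mul, ← C_add, ← C_sub, coeff_mul_C,
    hX, coeff_X_pow] at h'
  rw [← h', Finset.powersetCard_eq_filter, Finset.powerset_univ, Finset.sum_filter]
  refine Finset.sum_congr rfl fun A' _ => ?_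
  by_cases hA : A'.card = p
  · simp [hA]
  · rw [if_neg hA]
    simp [Ne.symm hA]

theorem reducedDet_eq_subresCore (f g : R[X]) {k : ℕ} (hf : f.Monic) (hg : g.Monic)
    (hfm : f.natDegree = m) (hgn : g.natDegree = n) (hkm : k ≤ m) (hkn : k < n)
    (b : Fin n → R) (x : R) (a : Fin m → R) (hb : ∀ j, g.eval (b j) = 0)
    (ha : ∀ i, f.eval (a i) = 0) (ν μ : R) :
    reducedDet (n + m - k) b x a ν μ = (-1) ^ ((m - k + 1) * (k + 1)) *
      ((Matrix.vandermonde b).det * (Matrix.vandermonde a).det) *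
        natDet ((n - k) + (m - k)) (subresCore f g m k x (-μ) (ν - μ)) := by
  rw [reducedDet, det_twoBlock_eq_natDet,
    natDet_twoBlock_eq_subresCore f g hf hg hfm hgn hkm hkn _ _ _ μ ν x,
    natDet_pow_eq_vandermonde b _ (extend_points_left b x a),
    natDet_pow_eq_vandermonde a (fun i => extend (points b x a) (n + 1 + i))
      (extend_points_right b x a)]
  · intro i hi
    rw [extend_points_left b x a ⟨i, hi⟩, hb]
  · intro i hi
    rw [extend_points_right b x a ⟨i, hi⟩, ha]
  · exact fun i hi => extend_points_left 1 ν 1 ⟨i, hi⟩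
  · exact fun i hi => extend_points_left (fun _ => 0) μ (fun _ => 1) ⟨i, hi⟩
  · exact extend_points_mid b x a
  · exact extend_points_mid _ _ _
  · exact extend_points_mid _ _ _
  · exact fun i hi => extend_points_right 1 ν 1 ⟨i, hi⟩
  · exact fun i hi => extend_points_right (fun _ => 0) μ (fun _ => 1) ⟨i, hi⟩

theorem reducedDet_X_eq [Nontrivial R] (f g : R[X]) {k : ℕ} (hf : f.Monic) (hg : g.Monic)
    (hfm : f.natDegree = m) (hgn : g.natDegree = n) (hkm : k ≤ m) (hkn : k < n)
    (b : Fin n → R) (a : Fin m → R) (hb : ∀ j, g.eval (b j) = 0)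
    (ha : ∀ i, f.eval (a i) = 0) (ν μ : R[X]) :
    reducedDet (n + m - k) (fun j => C (b j)) X (fun i => C (a i)) ν μ =
      (-1) ^ ((m - k + 1) * (k + 1)) * ((Matrix.vandermonde fun j => (C (b j) : R[X])).det *
        (Matrix.vandermonde fun i => (C (a i) : R[X])).det) *
      (cofF f g m n k * (-μ * f) + cofG f g m n k * ((ν - μ) * g)) := by
  have hf' := hf.map (C : R →+* R[X])
  have hg' := hg.map (C : R →+* R[X])
  have hfm' := (hf.natDegree_map (C : R →+* R[X])).trans hfm
  have hgn' := (hg.natDegree_map (C : R →+* R[X])).trans hgn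
  have hb' : ∀ j, (g.map C).eval (C (b j)) = 0 := fun j => by
    rw [eval_map, eval₂_at_apply, hb, C_0]
  have ha' : ∀ i, (f.map C).eval (C (a i)) = 0 := fun i => by
    rw [eval_map, eval₂_at_apply, ha, C_0]
  refine (reducedDet_eq_subresCore (R := R[X]) (m := m) (n := n) (f.map C) (g.map C) hf' hg' hfm'
    hgn' hkm hkn (fun j => C (b j)) X (fun i => C (a i)) hb' ha' ν μ).trans ?_
  rw [natDet_subresCore f g hkm hkn.le, det_subresMatrix_eq f g hkn]

end Generating

/-! ### Double sums over a field and the three ranges of `p + q`. -/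

section Field

variable {K : Type*} [Field K] {m n : ℕ}

theorem rootPoly_monic (Z : Finset K) : (rootPoly Z).Monic :=
  monic_prod_of_monic _ _ fun _ _ => monic_X_sub_C _

theorem natDegree_rootPoly (Z : Finset K) : (rootPoly Z).natDegree = Z.card := by
  rw [rootPoly, natDegree_prod_of_monic _ _ fun _ _ => monic_X_sub_C _]
  simp

theorem eval_rootPoly_eq_zero {Z : Finset K} {z : K} (hz : z ∈ Z) : (rootPoly Z).eval z = 0 := by
  rw [rootPoly, eval_prod]
  exact Finset.prod_eq_zero hz (by simp)

theorem C_diffProd_map {α β : Type*} (Y : Finset α) (Z : Finset β) (u : α ↪ K) (v : β ↪ K) :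
    C (diffProd (Y.map u) (Z.map v)) = crossProd Y Z (fun i => C (u i)) (fun j => C (v j)) := by
  simp [diffProd, crossProd]

theorem rootPoly_map {α : Type*} (Y : Finset α) (u : α ↪ K) :
    rootPoly (Y.map u) = crossProd (Finset.univ : Finset (Fin 1)) Y (fun _ => X)
      (fun j => C (u j)) := by
  simp [rootPoly, crossProd]

theorem diffProd_compl_ne_zero {α : Type*} [Fintype α] [DecidableEq α] (Y : Finset α)
    (u : α ↪ K) : diffProd (Y.map u) (Yᶜ.map u) ≠ 0 := by
  simp only [diffProd, Finset.prod_map, Finset.prod_ne_zero_iff, sub_ne_zero]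
  rintro i hi j hj h
  rw [u.injective h] at hi
  exact Finset.mem_compl.1 hj hi

theorem map_univ_sdiff {α T : Type*} [DecidableEq T] [Fintype α] [DecidableEq α] (Y : Finset α)
    (u : α ↪ T) : Finset.univ.map u \ Y.map u = Yᶜ.map u := by
  rw [← Finset.map_sdiff, Finset.compl_eq_univ_sdiff]

/-- The summand of Sylvester's double sum, for index sets `A'` and `B'`. -/
def doubleSumTerm (a : Fin m ↪ K) (b : Fin n ↪ K) (A' : Finset (Fin m)) (B' : Finset (Fin n)) :
    K[X] :=
  rootPoly (A'.map a) * rootPoly (B'.map b) *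
    C ((diffProd (A'.map a) (B'.map b) * diffProd (A'ᶜ.map a) (B'ᶜ.map b)) /
      (diffProd (A'.map a) (A'ᶜ.map a) * diffProd (B'.map b) (B'ᶜ.map b)))

theorem doubleSum_map [DecidableEq K] (p q : ℕ) (a : Fin m ↪ K) (b : Fin n ↪ K) :
    doubleSum p q (Finset.univ.map a) (Finset.univ.map b) =
      ∑ A' ∈ Finset.univ.powersetCard p, ∑ B' ∈ Finset.univ.powersetCard q,
        doubleSumTerm a b A' B' := by
  simp only [doubleSum, Finset.powersetCard_map, Finset.sum_map]
  refine Finset.sum_congr rfl fun A' _ => Finset.sum_congr rfl fun B' _ => ?_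
  simp only [doubleSumTerm, RelEmbedding.coe_toEmbedding, Finset.mapEmbedding_apply,
    map_univ_sdiff]

theorem doubleSumTerm_mul (a : Fin m ↪ K) (b : Fin n ↪ K) (A' : Finset (Fin m))
    (B' : Finset (Fin n)) :
    doubleSumTerm a b A' B' *
      (crossProd A' A'ᶜ (fun i => C (a i)) (fun i => C (a i)) *
        crossProd B' B'ᶜ (fun j => C (b j)) (fun j => C (b j))) =
      crossProd (Finset.univ : Finset (Fin 1)) A' (fun _ => X) (fun i => C (a i)) *
        crossProd (Finset.univ : Finset (Fin 1)) B' (fun _ => X) (fun j => C (b j)) *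
        (crossProd A' B' (fun i => C (a i)) (fun j => C (b j)) *
          crossProd A'ᶜ B'ᶜ (fun i => C (a i)) (fun j => C (b j))) := by
  rw [doubleSumTerm, ← rootPoly_map, ← rootPoly_map, ← C_diffProd_map, ← C_diffProd_map,
    ← C_diffProd_map, ← C_diffProd_map, mul_assoc, ← C_mul, ← C_mul, ← C_mul, div_mul_cancel₀]
  exact mul_ne_zero (diffProd_compl_ne_zero A' a) (diffProd_compl_ne_zero B' b)

/-- The product of the Vandermonde determinants of two families, as a constant polynomial. -/
def vandermondeProd (a : Fin m ↪ K) (b : Fin n ↪ K) : K[X] :=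
  (Matrix.vandermonde fun j => (C (b j) : K[X])).det *
    (Matrix.vandermonde fun i => (C (a i) : K[X])).det

theorem vandermondeProd_ne_zero (a : Fin m ↪ K) (b : Fin n ↪ K) : vandermondeProd a b ≠ 0 :=
  mul_ne_zero (Matrix.det_vandermonde_ne_zero_iff.2 (C_injective.comp b.injective))
    (Matrix.det_vandermonde_ne_zero_iff.2 (C_injective.comp a.injective))

/-- The Laplace term `blockDet` at the points of `b`, `X` and `a`. -/
def fieldBlockDet (a : Fin m ↪ K) (b : Fin n ↪ K) (L : ℕ) (B' : Finset (Fin n))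
    (x' : Finset (Fin 1)) (A' : Finset (Fin m)) : K[X] :=
  blockDet (pointEquiv m n) L (points (fun j => C (b j)) X (fun i => C (a i))) (triple B' x' A')

theorem crossProd_compl_ne_zero (a : Fin m ↪ K) (b : Fin n ↪ K) (A' : Finset (Fin m))
    (B' : Finset (Fin n)) :
    crossProd A' A'ᶜ (fun i => (C (a i) : K[X])) (fun i => C (a i)) *
        crossProd B' B'ᶜ (fun j => (C (b j) : K[X])) (fun j => C (b j)) ≠ 0 := by
  rw [← C_diffProd_map, ← C_diffProd_map, ← C_mul]
  exact C_ne_zero.2 (mul_ne_zero (diffProd_compl_ne_zero A' a) (diffProd_compl_ne_zero B' b))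

theorem fieldBlockDet_univ {L : ℕ} (hL : L ≤ n + (m + 1)) (a : Fin m ↪ K) (b : Fin n ↪ K)
    (B' : Finset (Fin n)) (A' : Finset (Fin m))
    (hc : B'.card + (1 + A'.card) = n + (m + 1) - L) :
    fieldBlockDet a b L B' Finset.univ A' = (-1) ^ (m + (m - A'.card) * B'.card) *
      (vandermondeProd a b * doubleSumTerm a b A' B') := by
  refine mul_right_cancel₀ (crossProd_compl_ne_zero a b A' B') ?_
  rw [fieldBlockDet, blockDet_triple_univ hL _ _ _ B' A' hc, ← doubleSumTerm_mul, vandermondeProd]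
  ring

theorem fieldBlockDet_empty {L : ℕ} (hL : L ≤ n + (m + 1)) (a : Fin m ↪ K) (b : Fin n ↪ K)
    (B' : Finset (Fin n)) (A' : Finset (Fin m))
    (hc : B'ᶜ.card + A'ᶜ.card = n + (m + 1) - L) :
    fieldBlockDet a b L B'ᶜ ∅ A'ᶜ =
      (-1) ^ (A'.card + (n - B'.card) + A'.card * (n - B'.card) + A'.card * (m - A'.card) +
        B'.card * (n - B'.card)) * (vandermondeProd a b * doubleSumTerm a b A' B') := by
  refine mul_right_cancel₀ (crossProd_compl_ne_zero a b A' B') ?_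
  rw [fieldBlockDet, blockDet_triple_empty hL _ _ _ B' A' hc, ← doubleSumTerm_mul, vandermondeProd]
  ring

theorem fieldBlockDet_eq_zero {k : ℕ} (hk : k ≤ n + m) (a : Fin m ↪ K) (b : Fin n ↪ K)
    (B' : Finset (Fin n)) (x' : Finset (Fin 1)) (A' : Finset (Fin m))
    (hc : B'.card + (x'.card + A'.card) ≠ k + 1) :
    fieldBlockDet a b (n + m - k) B' x' A' = 0 :=
  blockDet_eq_zero _ (by omega) _ _ (by rw [card_triple]; omega)

/-- `reducedDet` at the points of `b`, `X` and `a`. -/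
def fieldReducedDet (a : Fin m ↪ K) (b : Fin n ↪ K) (L : ℕ) (ν μ : K[X]) : K[X] :=
  reducedDet L (fun j => C (b j)) X (fun i => C (a i)) ν μ

theorem sum_compl_powersetCard {M : Type*} [AddCommMonoid M] {c p : ℕ} (hp : p ≤ c)
    (F : Finset (Fin c) → M) :
    ∑ s ∈ (Finset.univ : Finset (Fin c)).powersetCard p, F sᶜ =
      ∑ s ∈ (Finset.univ : Finset (Fin c)).powersetCard (c - p), F s := by
  refine Finset.sum_bij' (fun s _ => sᶜ) (fun s _ => sᶜ) ?_ ?_ ?_ ?_ ?_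
  · intro s hs
    rw [Finset.mem_powersetCard_univ] at hs ⊢
    rw [Finset.card_compl, hs, Fintype.card_fin]
  · intro s hs
    rw [Finset.mem_powersetCard_univ] at hs ⊢
    rw [Finset.card_compl, hs, Fintype.card_fin]
    omega
  · simp
  · simp
  · simp

theorem sum_powersetCard_eq_sum_univ {M : Type*} [AddCommMonoid M] {c q : ℕ}
    (F : Finset (Fin c) → M) (hF : ∀ s, s.card ≠ q → F s = 0) :
    ∑ s ∈ (Finset.univ : Finset (Fin c)).powersetCard q, F s = ∑ s, F s :=
  Finset.sum_subset (Finset.subset_univ _) fun s _ hs =>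
    hF s fun h => hs (Finset.mem_powersetCard_univ.2 h)

/-- The case `d = 0`, `c = 1`: `x` lies in the second block. The sum may run over all `B'`, since
terms of the wrong size vanish. -/
theorem vandermondeProd_mul_doubleSum_small [DecidableEq K] (a : Fin m ↪ K) (b : Fin n ↪ K)
    {p q k : ℕ} (hpq : p + q = k) (hk : 2 * k + 1 ≤ n + m) :
    vandermondeProd a b * doubleSum p q (Finset.univ.map a) (Finset.univ.map b) =
      (-1) ^ (m + (m - p) * q) * ((-1) ^ q * k.choose p *
        fieldReducedDet a b (n + m - k) 0 1) := by
  have h := sum_blockDet_coeff hk (fun j => (C (b j) : K[X])) X (fun i => C (a i)) 0 1 p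
  simp only [zero_mul, zero_add, one_mul, sub_zero, mul_zero, add_zero] at h
  rw [show k - p = q by omega] at h
  rw [fieldReducedDet, ← h, doubleSum_map, Finset.mul_sum, Finset.mul_sum]
  refine Finset.sum_congr rfl fun A' hA' => ?_
  rw [Finset.mem_powersetCard_univ] at hA'
  have hz := sum_powersetCard_eq_sum_univ (q := q)
    (fun B' : Finset (Fin n) => fieldBlockDet a b (n + m - k) B' Finset.univ A') fun B' hB' =>
      fieldBlockDet_eq_zero (by omega) a b B' Finset.univ A' (by simp; omega)
  change _ = _ * ∑ B', fieldBlockDet a b (n + m - k) B' Finset.univ A'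
  rw [← hz, Finset.mul_sum, Finset.mul_sum]
  refine Finset.sum_congr rfl fun B' hB' => ?_
  rw [Finset.mem_powersetCard_univ] at hB'
  rw [fieldBlockDet_univ (by omega) a b B' A' (by omega), hA', hB', ← mul_assoc, ← mul_pow]
  simp

/-- The case `d = 1`, `c = 0`: `x` lies in the first block, and the second block takes the
complements, of sizes `p'` and `q'`. -/
theorem vandermondeProd_mul_doubleSum_large [DecidableEq K] (a : Fin m ↪ K) (b : Fin n ↪ K)
    {p q k p' q' : ℕ} (hp : p + p' = m) (hq : q + q' = n) (hpq : p' + q' = k + 1)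
    (hk : 2 * k + 1 ≤ n + m) :
    vandermondeProd a b * doubleSum p q (Finset.univ.map a) (Finset.univ.map b) =
      (-1) ^ (p + q' + p * q' + p * p' + q * q') * ((-1) ^ q' *
        (k.choose p' * fieldReducedDet a b (n + m - k) 0 1 +
        (k + 1).choose p' * fieldReducedDet a b (n + m - k) 1 0)) := by
  have h := sum_blockDet_coeff hk (fun j => (C (b j) : K[X])) X (fun i => C (a i)) 1 0 p'
  simp only [zero_mul, add_zero, one_mul, zero_sub] at h
  have hs : (-1 : K[X]) ^ (k - p') * k.choose p' * (-1) = (-1) ^ q' * k.choose p' := by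
    -- For `q' = 0` the truncated `k - p'` gives the wrong sign, but then `p' = k + 1` and the
    -- binomial coefficient is zero.
    rcases Nat.eq_zero_or_pos q' with h0 | h0
    · rw [Nat.choose_eq_zero_of_lt (by omega)]; simp
    · rw [show q' = k - p' + 1 by omega]; ring
  have h2 : (-1 : K[X]) ^ q' * (k.choose p' * fieldReducedDet a b (n + m - k) 0 1 +
        (k + 1).choose p' * fieldReducedDet a b (n + m - k) 1 0) =
      ∑ A' ∈ Finset.univ.powersetCard p', ∑ B' : Finset (Fin n),
        fieldBlockDet a b (n + m - k) B' ∅ A' := by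
    refine Eq.trans ?_ h.symm
    rw [show k + 1 - p' = q' by omega, fieldReducedDet, fieldReducedDet]
    linear_combination (-reducedDet (n + m - k) (fun j => (C (b j) : K[X])) X
      (fun i => C (a i)) 0 1) * hs
  rw [h2, doubleSum_map, show p' = m - p by omega, ← sum_compl_powersetCard (by omega),
    Finset.mul_sum, Finset.mul_sum]
  refine Finset.sum_congr rfl fun A' hA' => ?_
  rw [Finset.mem_powersetCard_univ] at hA'
  have hz := sum_powersetCard_eq_sum_univ (q := n - q)
    (fun B' : Finset (Fin n) => fieldBlockDet a b (n + m - k) B' ∅ A'ᶜ) fun B' hB' =>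
      fieldBlockDet_eq_zero (by omega) a b B' ∅ A'ᶜ (by simp [Finset.card_compl]; omega)
  rw [← hz, ← sum_compl_powersetCard (by omega), Finset.mul_sum, Finset.mul_sum]
  refine Finset.sum_congr rfl fun B' hB' => ?_
  rw [Finset.mem_powersetCard_univ] at hB'
  rw [fieldBlockDet_empty (by omega) a b B' A' (by simp [Finset.card_compl]; omega), hA', hB',
    show q' = n - q by omega, ← mul_assoc, ← mul_pow]
  simp

theorem fieldReducedDet_eq (a : Fin m ↪ K) (b : Fin n ↪ K) {k : ℕ} (hkm : k ≤ m) (hkn : k < n)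
    (f g : K[X]) (hf : f = rootPoly (Finset.univ.map a)) (hg : g = rootPoly (Finset.univ.map b))
    (ν μ : K[X]) :
    fieldReducedDet a b (n + m - k) ν μ = (-1) ^ ((m - k + 1) * (k + 1)) * vandermondeProd a b *
      (cofF f g m n k * (-μ * f) + cofG f g m n k * ((ν - μ) * g)) := by
  have hfm : f.natDegree = m := by rw [hf, natDegree_rootPoly]; simp
  have hgn : g.natDegree = n := by rw [hg, natDegree_rootPoly]; simp
  rw [fieldReducedDet, vandermondeProd]
  refine reducedDet_X_eq f g (hf ▸ rootPoly_monic _) (hg ▸ rootPoly_monic _) hfm hgn hkm hkn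
    (fun j => b j) (fun i => a i) (fun j => ?_) (fun i => ?_) ν μ
  · rw [hg, eval_rootPoly_eq_zero (by simp)]
  · rw [hf, eval_rootPoly_eq_zero (by simp)]

theorem fieldReducedDet_eq_zero (a : Fin m ↪ K) (b : Fin n ↪ K) {k : ℕ} (hkm : m < k)
    (hk : k ≤ n + m) (ν μ : K[X]) : fieldReducedDet a b (n + m - k) ν μ = 0 := by
  refine det_twoBlock_eq_zero _ (by omega) _ _ _ (triple ∅ Finset.univ Finset.univ) ?_ ?_
  · rw [card_triple]
    simp
    omega
  · rintro (i | i | i) hi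
    · rfl
    · exact absurd (by simp [triple, Subsingleton.elim i 0]) hi
    · exact absurd (by simp [triple]) hi

theorem neg_one_zpow_eq_pow {z : ℤ} {e : ℕ} (h : Even z ↔ Even e) : (-1 : K) ^ z = (-1) ^ e := by
  by_cases he : Even e
  · rw [(h.2 he).neg_one_zpow, he.neg_one_pow]
  · rw [(Int.not_even_iff_odd.1 (h.not.2 he)).neg_one_zpow, (Nat.not_even_iff_odd.1 he).neg_one_pow]

theorem choose_succ_add_eq {k p' q' : ℕ} (h : p' + q' = k + 1) :
    (k + 1).choose p' = k.choose p' + k.choose q' := by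
  rcases p' with _ | r
  · rw [Nat.choose_zero_right, Nat.choose_zero_right, Nat.choose_eq_zero_of_lt (by omega)]
  · rw [Nat.choose_succ_succ, add_comm, show q' = k - r by omega, Nat.choose_symm (by omega)]

theorem doubleSum_eq_Sres [DecidableEq K] (a : Fin m ↪ K) (b : Fin n ↪ K) {p q k : ℕ}
    (hpq : p + q = k) (hkm : k ≤ m) (hkn : k < n)
    (f g : K[X]) (hf : f = rootPoly (Finset.univ.map a)) (hg : g = rootPoly (Finset.univ.map b)) :
    doubleSum p q (Finset.univ.map a) (Finset.univ.map b) =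
      (-1) ^ (p * (m - k)) * (k.choose p : K[X]) * Sres f g m n k := by
  refine mul_left_cancel₀ (vandermondeProd_ne_zero a b) ?_
  rw [vandermondeProd_mul_doubleSum_small a b hpq (by omega), fieldReducedDet_eq a b hkm hkn f g hf hg,
    Sres, det_subresMatrix_eq f g hkn]
  -- The final `+ 1` in the exponent accounts for `(ν, μ) = (0, 1)` producing `-Sres`.
  have hs : (-1 : K[X]) ^ (p * (m - k)) =
      (-1) ^ (m + (m - p) * q + q + (m - k + 1) * (k + 1) + 1) := by
    obtain ⟨r, rfl⟩ := Nat.exists_eq_add_of_le hkm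
    subst hpq
    rw [Nat.add_sub_cancel_left, show p + q + r - p = q + r by omega]
    refine neg_one_pow_congr ?_
    simp only [Nat.even_add, Nat.even_mul, Nat.not_even_one]
    tauto
  rw [hs]
  ring

theorem doubleSum_eq_zero [DecidableEq K] (a : Fin m ↪ K) (b : Fin n ↪ K) {p q : ℕ}
    (hp : p ≤ m) (hq : q ≤ n) (h1 : m + 1 ≤ p + q) (h2 : p + q + 2 ≤ n) :
    doubleSum p q (Finset.univ.map a) (Finset.univ.map b) = 0 := by
  refine mul_left_cancel₀ (vandermondeProd_ne_zero a b) ?_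
  -- Whichever expansion satisfies the size condition, its index `p + q` or `m + n - (p + q) - 1`
  -- exceeds `m`.
  by_cases h : 2 * (p + q) + 1 ≤ n + m
  · rw [vandermondeProd_mul_doubleSum_small a b rfl h, fieldReducedDet_eq_zero a b h1 (by omega)]
    ring
  · rw [vandermondeProd_mul_doubleSum_large a b (k := m + n - (p + q) - 1) (p' := m - p)
      (q' := n - q) (by omega) (by omega) (by omega) (by omega),
      fieldReducedDet_eq_zero a b (by omega) (by omega),
      fieldReducedDet_eq_zero a b (by omega) (by omega)]
    ring

theorem doubleSum_eq_largeValue [DecidableEq K] (a : Fin m ↪ K) (b : Fin n ↪ K) {p q k : ℕ}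
    (hp : p ≤ m) (hq : q ≤ n) (hk : p + q + k + 1 = m + n) (hkm : k ≤ m) (hkn : k < n)
    (f g : K[X]) (hf : f = rootPoly (Finset.univ.map a)) (hg : g = rootPoly (Finset.univ.map b)) :
    doubleSum p q (Finset.univ.map a) (Finset.univ.map b) = largeValue f g m n p q := by
  refine mul_left_cancel₀ (vandermondeProd_ne_zero a b) ?_
  obtain ⟨p', rfl⟩ := Nat.exists_eq_add_of_le hp
  obtain ⟨q', rfl⟩ := Nat.exists_eq_add_of_le hq
  rw [vandermondeProd_mul_doubleSum_large a b (k := k) rfl rfl (by omega) (by omega),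
    fieldReducedDet_eq a b hkm hkn f g hf hg, fieldReducedDet_eq a b hkm hkn f g hf hg, largeValue,
    show p + p' + (q + q') - (p + q) - 1 = k by omega, Nat.add_sub_cancel_left,
    Nat.add_sub_cancel_left, choose_succ_add_eq (show p' + q' = k + 1 by omega)]
  -- After Pascal's rule the bracket is `-binom(k, p') F f + binom(k, q') G g`; the final `+ 1` in
  -- the exponent absorbs its opposite sign.
  have hs : (C ((-1 : K) ^ ((((p + p' : ℕ) : ℤ) - p) * (((q + q' : ℕ) : ℤ) - q) +
      ((q + q' : ℕ) : ℤ) - p - 1 + ((q + q' : ℕ) : ℤ) * q)) : K[X]) =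
      (-1) ^ (p + q' + p * q' + p * p' + q * q' + q' + (p + p' - k + 1) * (k + 1) + 1) := by
    rw [neg_one_zpow_eq_pow (e := p + q' + p * q' + p * p' + q * q' + q' +
      (p + p' - k + 1) * (k + 1) + 1)]
    · simp
    · obtain ⟨r, hr⟩ := Nat.exists_eq_add_of_le hkm
      have hk' : k + 1 = p' + q' := by omega
      have hr' : p + 1 = q' + r := by omega
      rw [show p + p' - k + 1 = r + 1 by omega, hk']
      have e1 := congrArg Even hr'
      simp only [eq_iff_iff, Nat.even_add, Nat.not_even_one] at e1
      push_cast
      simp only [Int.even_add, Int.even_sub, Int.even_mul, Int.even_coe_nat, Nat.even_add,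
        Nat.even_mul, Nat.not_even_one, Int.not_even_one]
      revert e1
      generalize Even p = P, Even p' = P', Even q = Q, Even q' = Q', Even r = S
      intro e1
      by_cases hP : P <;> by_cases hP' : P' <;> by_cases hQ : Q <;> by_cases hQ' : Q' <;>
        simp only [hP, hQ', true_iff, false_iff, not_not, not_true, iff_false] at e1 <;> simp [hP, hP', hQ, hQ', e1]
  rw [hs]
  push_cast
  ring

/-- Only `A' = A`, `B' = B` contributes, and the resultant of the two root polynomials is `R(A, B)`.
-/
theorem doubleSum_card_card [DecidableEq K] (A B : Finset K) :
    doubleSum A.card B.card A B =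
      C (resultant (rootPoly A) (rootPoly B)) * rootPoly A * rootPoly B := by
  have hres : resultant (rootPoly A) (rootPoly B) = diffProd A B := by
    conv_lhs => rw [rootPoly]
    rw [resultant_prod_left _ _ _ _ (by simp) le_rfl, diffProd]
    refine Finset.prod_congr rfl fun y _ => ?_
    rw [natDegree_X_sub_C, resultant_X_sub_C_left _ _ _ le_rfl, rootPoly, eval_prod]
    simp
  rw [doubleSum, Finset.powersetCard_self, Finset.sum_singleton, Finset.powersetCard_self,
    Finset.sum_singleton, hres]
  simp [diffProd]
  ring

end Field

end SylvesterSums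

end

/-! ### Assembly of the cases, after enumerating `A` and `B`. -/

theorem theorem1 {K : Type*} [Field K] [DecidableEq K] (A B : Finset K) (m n p q k : ℕ)
    (hA : A.card = m) (hB : B.card = n) (hm : 1 ≤ m) (hmn : m ≤ n)
    (hp : p ≤ m) (hq : q ≤ n) (hk : k = p + q)
    (f g : K[X]) (hf : f = SylvesterSums.rootPoly A) (hg : g = SylvesterSums.rootPoly B) :
    ((p, q) ≠ (m, n) →
      (m < n →
        (k ≤ m → SylvesterSums.doubleSum p q A B =
          (-1) ^ (p * (m - k)) * (k.choose p : K[X]) * SylvesterSums.Sres f g m n k) ∧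
        (m + 1 ≤ k → k + 2 ≤ n → SylvesterSums.doubleSum p q A B = 0) ∧
        (n ≤ k + 1 → k + 1 ≤ m + n →
          SylvesterSums.doubleSum p q A B = SylvesterSums.largeValue f g m n p q)) ∧
      (m = n →
        (k + 1 ≤ m → SylvesterSums.doubleSum p q A B =
          (-1) ^ (p * (m - k)) * (k.choose p : K[X]) * SylvesterSums.Sres f g m n k) ∧
        (m ≤ k → k + 1 ≤ 2 * m →
          SylvesterSums.doubleSum p q A B = SylvesterSums.largeValue f g m n p q))) ∧
    ((p, q) = (m, n) →
      SylvesterSums.doubleSum p q A B = C (resultant f g) * f * g) := by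
  obtain ⟨a, ha⟩ : ∃ a : Fin m ↪ K, Finset.univ.map a = A :=
    ⟨(A.equivFinOfCardEq hA).symm.toEmbedding.trans (Function.Embedding.subtype _), by
      rw [← Finset.map_map, Finset.map_univ_equiv, Finset.univ_eq_attach, Finset.attach_map_val]⟩
  obtain ⟨b, hb⟩ : ∃ b : Fin n ↪ K, Finset.univ.map b = B :=
    ⟨(B.equivFinOfCardEq hB).symm.toEmbedding.trans (Function.Embedding.subtype _), by
      rw [← Finset.map_map, Finset.map_univ_equiv, Finset.univ_eq_attach, Finset.attach_map_val]⟩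
  refine ⟨fun _ => ⟨fun hlt => ⟨fun h => ?_, fun h1 h2 => ?_, fun h1 h2 => ?_⟩,
    fun heq => ⟨fun h => ?_, fun h1 h2 => ?_⟩⟩, fun h => ?_⟩
  · subst ha hb
    exact SylvesterSums.doubleSum_eq_Sres a b hk.symm h (by omega) f g hf hg
  · rw [← ha, ← hb]
    exact SylvesterSums.doubleSum_eq_zero a b hp hq (by omega) (by omega)
  · subst ha hb
    exact SylvesterSums.doubleSum_eq_largeValue a b (k := m + n - (p + q) - 1) hp hq (by omega)
      (by omega) (by omega) f g hf hg
  · subst ha hb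
    exact SylvesterSums.doubleSum_eq_Sres a b hk.symm (by omega) (by omega) f g hf hg
  · subst ha hb
    exact SylvesterSums.doubleSum_eq_largeValue a b (k := m + n - (p + q) - 1) hp hq (by omega)
      (by omega) (by omega) f g hf hg
  · obtain ⟨rfl, rfl⟩ := Prod.mk.inj h
    rw [hf, hg, ← hA, ← hB]
    exact SylvesterSums.doubleSum_card_card A B
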